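/- Let $N$ be an infinite finitely generated $\mathbb{Z}[x]$-module. For $n\ge 1$ let $m_n(N)$ be the number of maximal $\mathbb{Z}[x]$-submodules of $N$ of index $n$; this number is finite. For a prime $p$ let $r(p)$ be the torsion-free rank of the $\mathbb{F}_p[x]$-module $N/pN$, and let $r_{\max}=\max_p r(p)$, the maximum over all primes, which exists. By the structure theorem over the principal ideal domain $\mathbb{Q}[x]$ there is a decomposition $$\mathbb{Q}\otimes_{\mathbb{Z}}N\;\cong_{\mathbb{Q}[x]}\;\Big(\bigoplus_{j=1}^{s(0)}\mathbb{Q}[x]/(a_j)\Big)\oplus\mathbb{Q}[x]^{r(0)}$$ with nonzero nonunits $a_j\in\mathbb{Q}[x]$ such that $a_1\mid a_2\mid\cdots\mid a_{s(0)}$. For any such decomposition put $d=s(0)+r(0)$. Say that $f:\{1,2,3,\dots\}\to\mathbb{R}$ has growth type $g$ if there is a constant $C$ with $|f(n)|\le C\,g(n)$ for all large $n$, and there is a constant $c>0$ with $c\,g(n)\le f(n)$ for infinitely many $n$. Then the function $n\mapsto m_n(N)$ has growth type $$\begin{cases} n^{d-1} & \text{if } d>r_{\max},\\ n^{d} & \text{if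 } d=r_{\max}=r(0),\\ n^{r_{\max}}/\log n & \text{otherwise.}\end{cases}$$ -/

import Mathlib

open Polynomial Filter

/-- `f` has growth type at most `g`: `f(n) = O(g(n))`. -/
def GrowthTypeAtMost (f g : ℕ → ℝ) : Prop :=
  ∃ C : ℝ, ∀ᶠ n in atTop, |f n| ≤ C * g n

/-- `f` has growth type at least `g`: for some `C > 0`, `C g(n) ≤ f(n)` for infinitely many `n`. -/
def GrowthTypeAtLeast (f g : ℕ → ℝ) : Prop :=
  ∃ C : ℝ, 0 < C ∧ ∃ᶠ n in atTop, C * g n ≤ f n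

/-- `f` has growth type `g`. -/
def HasGrowthType (f g : ℕ → ℝ) : Prop :=
  GrowthTypeAtMost f g ∧ GrowthTypeAtLeast f g

/-- The set of maximal `R`-submodules of `N` of index `n`. -/
def maxSubmodules (R N : Type*) [Ring R] [AddCommGroup N] [Module R N] (n : ℕ) :
    Set (Submodule R N) :=
  {M | IsCoatom M ∧ M.toAddSubgroup.index = n}

/-- The number of maximal `R`-submodules of `N` of index `n`. -/
noncomputable def maxSubmoduleCount (R N : Type*) [Ring R] [AddCommGroup N] [Module R N]
    (n : ℕ) : ℕ :=
  (maxSubmodules R N n).ncard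

section ZXModules

universe u

variable (N : Type u) [AddCommGroup N] [Module ℤ[X] N]

/-- Multiplication by `x` on a `ℤ[x]`-module, as an additive map. -/
noncomputable def mulX : N →ₗ[ℤ] N :=
  (DistribSMul.toAddMonoidHom N (X : ℤ[X])).toIntLinearMap

/-- The `ℚ[x]`-module `ℚN = ℚ ⊗_ℤ N`, on which `x` acts as `id ⊗ x`. -/
abbrev RatModule : Type u :=
  Module.AEval' ((mulX N).baseChange ℚ)

/-- The quotient `N/pN`. -/
abbrev QuotModP (p : ℕ) : Type u :=
  N ⧸ (Ideal.span {(p : ℤ[X])} • ⊤ : Submodule ℤ[X] N)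

theorem QuotModP.nsmul_eq_zero (p : ℕ) (y : QuotModP N p) : p • y = 0 := by
  obtain ⟨m, rfl⟩ := Submodule.Quotient.mk_surjective _ y
  rw [← Nat.cast_smul_eq_nsmul ℤ[X], ← Submodule.Quotient.mk_smul]
  exact (Submodule.Quotient.mk_eq_zero _).2
    (Submodule.smul_mem_smul (Ideal.mem_span_singleton_self _) trivial)

/-- `N/pN` is an `𝔽_p`-vector space. -/
noncomputable instance QuotModP.instModuleZMod (p : ℕ) : Module (ZMod p) (QuotModP N p) :=
  AddCommGroup.zmodModule (QuotModP.nsmul_eq_zero N p)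

/-- `N/pN` as an `𝔽_p[x]`-module. -/
abbrev ModPModule (p : ℕ) : Type u :=
  Module.AEval' ((mulX (QuotModP N p)).toAddMonoidHom.toZModLinearMap p)

/-- `r(p)`: the torsion-free rank of the `𝔽_p[x]`-module `N/pN` (the largest number of
`𝔽_p[x]`-linearly independent elements). -/
noncomputable def rankModP (p : Nat.Primes) : ℕ :=
  Module.finrank (ZMod (p : ℕ))[X] (ModPModule N (p : ℕ))

/-- `r_max`: the maximum of `r(p)` over all primes `p`. -/
noncomputable def rankMax : ℕ :=
  sSup (Set.range (rankModP N))

/-- `ℚN ≅ ⨁_{j < s} ℚ[x]/(a_j) ⊕ ℚ[x]^r` over `ℚ[x]`, with the `a_j` nonzero nonunits such that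
`a_1 ∣ a_2 ∣ ⋯ ∣ a_s`. -/
def HasInvariantFactorForm (s r : ℕ) : Prop :=
  ∃ a : Fin s → ℚ[X],
    (∀ j, a j ≠ 0 ∧ ¬ IsUnit (a j)) ∧
    (∀ i j, i ≤ j → a i ∣ a j) ∧
    Nonempty (RatModule N ≃ₗ[ℚ[X]] (Π j, ℚ[X] ⧸ Ideal.span {a j}) × (Fin r → ℚ[X]))

end ZXModules

/-! The quotient by a maximal submodule is a residue field of `ℤ[X]`. If the index is finite and
positive, it is a prime power `q = p ^ k`, and the submodule is the kernel of a nonzero map `N → F`,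
where `F` has `q` elements, semilinear along a surjection `ℤ[X] → F`, `X ↦ α`. Units and
automorphisms of `F` act simply transitively on the maps with a given kernel. Hence `m_q(N) * (q -
1) * k = ∑ (h(α) - 1)`, where `α` runs over the generators of `F` and `h(α)` counts the maps on
which `X` acts as `α` (`card_maxSubmodules_mul_eq`, `maxSubmoduleCount_mul_eq`). Everything reduces
to computing `h(α) = q ^ (fibre dimension at α)`.

Large `p`. The decomposition of `ℚN` spreads out over `ℤ` up to kernel and cokernel killed by one
integer (`exists_spreading_out`), so `h(α) = q ^ (r + #{j | b j (α) = 0})` for integral multiples `b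
j` of the invariant factors. The exponent is `r` outside boundedly many `α`, and it is `s + r` at a
root of the first factor, whose residue degree is bounded (`HasInvariantFactorForm.exists_generic`).
So `m_q` is at most of order `(q ^ r + q ^ (s + r - 1)) / k`. The second term is attained infinitely
often if `s > 0`, and the first at `q = p` if `s = 0` and `r > 0`.

Fixed `p`. For large `k` a generator avoids the torsion of `N/pN`, so `h(α) = q ^ r(p)`
(`exists_homCard_eq_pow_rankModP`). At least half of `F` consists of generators, so when `r(p) > 0`
the order is `q ^ r(p) / k`, with `k = log q / log p`. This is the source of `n ^ r_max / log n`.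

Since `r(p) = r` for large `p`, one has `r ≤ r_max`, and comparing these contributions gives the
three cases. Infinitude of `N` excludes `d = r_max = 0`. -/

/-! ### Semilinear maps from a module to a field, and their number. -/

section SemilinearMaps

variable {R F : Type*} [CommRing R] [Field F]

/-- Precomposition with a linear map whose kernel and cokernel are killed by a scalar `c` that
becomes invertible in `F` is a bijection on semilinear maps into `F`. -/
theorem bijective_precomp_of_smul {P N : Type*} [AddCommGroup P] [Module R P] [AddCommGroup N]
    [Module R N] (ε : R →+* F) (v : P →ₗ[R] N) (c : R) (hε : ε c ≠ 0)
    (hker : ∀ y, v y = 0 → c • y = 0) (hrange : ∀ n, ∃ y, v y = c • n) :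
    Function.Bijective fun φ : N →ₛₗ[ε] F => (φ.comp v : P →ₛₗ[ε] F) := by
  constructor
  · intro φ ψ h
    ext n
    obtain ⟨y, hy⟩ := hrange n
    have h1 : φ (v y) = ψ (v y) := LinearMap.congr_fun h y
    rw [hy, map_smulₛₗ, map_smulₛₗ] at h1
    exact mul_left_cancel₀ hε h1
  · intro ψ
    choose g hg using hrange
    have key : ∀ y z, v y = v z → ψ y = ψ z := by
      intro y z h
      have h1 := hker (y - z) (by rw [map_sub, h, sub_self])
      have h2 : ε c • ψ (y - z) = 0 := by rw [← map_smulₛₗ, h1, map_zero]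
      rw [smul_eq_mul, mul_eq_zero, or_iff_right hε, map_sub, sub_eq_zero] at h2
      exact h2
    -- Since `v (g n) = c • n`, semilinearity forces this value; `key` makes it independent of the
    -- choice of `g`.
    refine ⟨{ toFun := fun n => (ε c)⁻¹ * ψ (g n), map_add' := ?_, map_smul' := ?_ }, ?_⟩
    · intro a b
      rw [← mul_add, ← map_add]
      congr 1
      exact key _ _ (by rw [map_add, hg, hg, hg, smul_add])
    · intro a b
      rw [key (g (a • b)) (a • g b) (by rw [map_smul, hg, hg, smul_comm]), map_smulₛₗ]
      simp only [smul_eq_mul]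
      ring
    · ext y
      have h2 : ψ (g (v y)) = ε c * ψ y := by
        rw [key (g (v y)) (c • y) (by rw [map_smul, hg]), map_smulₛₗ, smul_eq_mul]
      change (ε c)⁻¹ * ψ (g (v y)) = ψ y
      rw [h2, inv_mul_cancel_left₀ hε]

theorem card_semilinearMap_eq_of_smul {P N : Type*} [AddCommGroup P] [Module R P] [AddCommGroup N]
    [Module R N] (ε : R →+* F) (v : P →ₗ[R] N) (c : R) (hε : ε c ≠ 0)
    (hker : ∀ y, v y = 0 → c • y = 0) (hrange : ∀ n, ∃ y, v y = c • n) :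
    Nat.card (N →ₛₗ[ε] F) = Nat.card (P →ₛₗ[ε] F) :=
  Nat.card_congr (Equiv.ofBijective _ (bijective_precomp_of_smul ε v c hε hker hrange))

/-- The semilinear map on a cyclic module with a prescribed value at the generator. -/
noncomputable def semilinearMapOfCyclic (ε : R →+* F) (b : R) (y : F) (hy : ε b * y = 0) :
    (R ⧸ Ideal.span {b}) →ₛₗ[ε] F :=
  Submodule.liftQ (Ideal.span {b})
    ({ toFun := fun f => ε f * y, map_add' := by intros; rw [map_add, add_mul],
       map_smul' := by intros; simp [mul_assoc] } : R →ₛₗ[ε] F)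
    (by
      rw [Ideal.span, Submodule.span_singleton_le_iff_mem, LinearMap.mem_ker]
      exact hy)

theorem semilinearMapOfCyclic_mk (ε : R →+* F) (b : R) (y : F) (hy : ε b * y = 0) (f : R) :
    semilinearMapOfCyclic ε b y hy (Ideal.Quotient.mk _ f) = ε f * y := rfl

theorem bijective_eval_single {ι : Type*} [Fintype ι] [DecidableEq ι] (ε : R →+* F) (b : ι → R) :
    Function.Bijective fun φ : (Π i, R ⧸ Ideal.span {b i}) →ₛₗ[ε] F =>
      (fun i => ⟨φ (Pi.single i 1), by
        rw [← smul_eq_mul, ← map_smulₛₗ, ← Pi.single_smul, Algebra.smul_def, mul_one]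
        have : algebraMap R (R ⧸ Ideal.span {b i}) (b i) = 0 :=
          Ideal.Quotient.eq_zero_iff_mem.2 (Ideal.mem_span_singleton_self _)
        rw [this, Pi.single_zero, map_zero]⟩ : Π i, {y : F // ε (b i) * y = 0}) := by
  constructor
  · intro φ ψ h
    refine LinearMap.ext fun w => ?_
    choose f hf using fun i => Ideal.Quotient.mk_surjective (I := Ideal.span {b i}) (w i)
    have hw : w = ∑ i, f i • Pi.single i (1 : R ⧸ Ideal.span {b i}) := by
      rw [← Finset.univ_sum_single w]
      refine Finset.sum_congr rfl fun i _ => ?_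
      rw [← Pi.single_smul, ← hf, Algebra.smul_def, mul_one]
      rfl
    rw [hw, map_sum, map_sum]
    refine Finset.sum_congr rfl fun i _ => ?_
    rw [map_smulₛₗ, map_smulₛₗ]
    congr 1
    exact congr_arg Subtype.val (congr_fun h i)
  · intro y
    refine ⟨∑ i, (semilinearMapOfCyclic ε (b i) (y i).1 (y i).2).comp
      (LinearMap.proj (R := R) (φ := fun i => R ⧸ Ideal.span {b i}) i), ?_⟩
    funext i
    apply Subtype.ext
    simp only [LinearMap.sum_apply, LinearMap.comp_apply, LinearMap.proj_apply]
    rw [Finset.sum_eq_single i]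
    · rw [Pi.single_eq_same, ← map_one (Ideal.Quotient.mk _), semilinearMapOfCyclic_mk, map_one,
        one_mul]
    · intro j _ hj
      rw [Pi.single_eq_of_ne hj, map_zero]
    · simp

-- The image `y` of the `i`-th generator is subject only to `ε (b i) * y = 0`. In a field this
-- allows every `y` or only `0`.
open Classical in
theorem card_semilinearMap_pi_quotient {ι : Type*} [Fintype ι] [Finite F]
    (ε : R →+* F) (b : ι → R) :
    Nat.card ((Π i, R ⧸ Ideal.span {b i}) →ₛₗ[ε] F) =
      Nat.card F ^ (Finset.univ.filter fun i => ε (b i) = 0).card := by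
  rw [Nat.card_congr (Equiv.ofBijective _ (bijective_eval_single ε b)), Nat.card_pi]
  have : ∀ i, Nat.card {y : F // ε (b i) * y = 0} = if ε (b i) = 0 then Nat.card F else 1 := by
    intro i
    split_ifs with h
    · simp only [h, zero_mul]
      exact Nat.card_congr (Equiv.subtypeUnivEquiv fun _ => trivial)
    · simp [h]
  rw [Finset.prod_congr rfl fun i _ => this i, Finset.prod_ite]
  simp

theorem card_semilinearMap_finFun {r : ℕ} [Finite F] (ε : R →+* F) :
    Nat.card ((Fin r → R) →ₛₗ[ε] F) = Nat.card F ^ r := by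
  classical
  -- A free module is the case where every modulus is `0`.
  have h := card_semilinearMap_pi_quotient ε (fun _ : Fin r => (0 : R))
  simp only [map_zero, Finset.filter_true, Finset.card_univ, Fintype.card_fin] at h
  rw [← h]
  have hbot : Ideal.span {(0 : R)} = ⊥ := by simp
  exact card_semilinearMap_eq_of_smul ε
    (LinearEquiv.piCongrRight fun _ : Fin r => Submodule.quotEquivOfEqBot _ hbot).toLinearMap 1
    (by simp) (fun y hy => by simpa using hy) (fun n => by
      rw [one_smul]; exact LinearEquiv.surjective _ n)

theorem finite_semilinearMap {N : Type*} [AddCommGroup N] [Module R N] [Module.Finite R N]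
    [Finite F] (ε : R →+* F) : Finite (N →ₛₗ[ε] F) := by
  obtain ⟨s, hs⟩ := Module.Finite.fg_top (R := R) (M := N)
  refine Finite.of_injective (fun (φ : N →ₛₗ[ε] F) (i : s) => φ i) fun φ ψ h => ?_
  exact LinearMap.ext_on hs fun x hx => congr_fun h ⟨x, hx⟩

end SemilinearMaps

/-! ### Maximal submodules as kernels of maps onto finite fields. -/

section MaximalSubmodules

variable {R F : Type*} [CommRing R] [Field F] {N : Type*} [AddCommGroup N] [Module R N]

theorem surjective_of_ne_zero {ε : R →+* F} (hε : Function.Surjective ε) {φ : N →ₛₗ[ε] F}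
    (hφ : φ ≠ 0) : Function.Surjective φ := by
  obtain ⟨n, hn⟩ : ∃ n, φ n ≠ 0 := by
    by_contra! h
    exact hφ (LinearMap.ext h)
  intro y
  obtain ⟨f, hf⟩ := hε (y / φ n)
  exact ⟨f • n, by rw [map_smulₛₗ, hf, smul_eq_mul, div_mul_cancel₀ _ hn]⟩

theorem isCoatom_ker {ε : R →+* F} (hε : Function.Surjective ε) {φ : N →ₛₗ[ε] F}
    (hφ : φ ≠ 0) : IsCoatom (LinearMap.ker φ) := by
  refine ⟨fun h => hφ (LinearMap.ker_eq_top.1 h), fun M hM => ?_⟩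
  obtain ⟨m, hm, hmk⟩ := SetLike.exists_of_lt hM
  rw [LinearMap.mem_ker] at hmk
  rw [eq_top_iff]
  intro n _
  obtain ⟨f, hf⟩ := hε (φ n / φ m)
  have h1 : n - f • m ∈ LinearMap.ker φ := by
    rw [LinearMap.mem_ker, map_sub, map_smulₛₗ, hf, smul_eq_mul, div_mul_cancel₀ _ hmk, sub_self]
  have := M.add_mem (hM.le h1) (M.smul_mem f hm)
  rwa [sub_add_cancel] at this

theorem index_ker {ε : R →+* F} (hε : Function.Surjective ε) {φ : N →ₛₗ[ε] F}
    (hφ : φ ≠ 0) : (LinearMap.ker φ).toAddSubgroup.index = Nat.card F := by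
  have h := AddSubgroup.index_ker φ.toAddMonoidHom
  have h2 : (LinearMap.ker φ).toAddSubgroup = φ.toAddMonoidHom.ker := rfl
  rw [h2, h, AddMonoidHom.range_eq_top.2 (surjective_of_ne_zero hε hφ)]
  exact Nat.card_congr AddSubgroup.topEquiv.toEquiv

/-- A maximal submodule gives a residue field. -/
theorem exists_maximal_ideal_of_isCoatom {M : Submodule R N} (hM : IsCoatom M) :
    ∃ I : Ideal R, I.IsMaximal ∧ Nonempty ((N ⧸ M) ≃ₗ[R] R ⧸ I) := by
  have : IsSimpleModule R (N ⧸ M) := isSimpleModule_iff_isCoatom.2 hM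
  exact isSimpleModule_iff_quot_maximal.1 this

theorem isPrimePow_of_mem_maxSubmodules {n : ℕ} (hn : 0 < n) {M : Submodule R N}
    (hM : M ∈ maxSubmodules R N n) : IsPrimePow n := by
  obtain ⟨I, hI, ⟨e⟩⟩ := exists_maximal_ideal_of_isCoatom hM.1
  let := Ideal.Quotient.field I
  have hcard : Nat.card (R ⧸ I) = n := by
    rw [← hM.2, ← Nat.card_congr e.toEquiv]; rfl
  have : Finite (R ⧸ I) := Nat.finite_of_card_ne_zero (by omega)
  let := Fintype.ofFinite (R ⧸ I)
  rw [← hcard, Nat.card_eq_fintype_card]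
  exact FiniteField.isPrimePow_card (R ⧸ I)

/-- Finite fields of equal cardinality are isomorphic, so the residue field at `M` may be replaced
by `F`. -/
theorem exists_ker_eq_of_mem_maxSubmodules [Finite F] {M : Submodule R N}
    (hM : M ∈ maxSubmodules R N (Nat.card F)) :
    ∃ (ε : R →+* F) (φ : N →ₛₗ[ε] F), Function.Surjective ε ∧ φ ≠ 0 ∧ LinearMap.ker φ = M := by
  obtain ⟨I, hI, ⟨e⟩⟩ := exists_maximal_ideal_of_isCoatom hM.1
  let := Ideal.Quotient.field I
  have hcard : Nat.card (R ⧸ I) = Nat.card F := by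
    rw [← hM.2, ← Nat.card_congr e.toEquiv]; rfl
  have : Finite (R ⧸ I) := Nat.finite_of_card_ne_zero (by rw [hcard]; exact Nat.card_pos.ne')
  let := Fintype.ofFinite (R ⧸ I)
  let := Fintype.ofFinite F
  let σ : (R ⧸ I) ≃+* F := FiniteField.ringEquivOfCardEq (by
    rw [← Nat.card_eq_fintype_card, ← Nat.card_eq_fintype_card, hcard])
  let φ : N →ₛₗ[σ.toRingHom.comp (Ideal.Quotient.mk I)] F :=
    { toFun := fun n => σ (e (Submodule.Quotient.mk n))
      map_add' := by intros; simp
      map_smul' := by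
        intro f n
        rw [Submodule.Quotient.mk_smul, map_smul, Algebra.smul_def, map_mul]; rfl }
  have hker : LinearMap.ker φ = M := by
    ext n
    rw [LinearMap.mem_ker]
    change σ (e (Submodule.Quotient.mk n)) = 0 ↔ _
    rw [map_eq_zero_iff _ σ.injective, e.map_eq_zero_iff, Submodule.Quotient.mk_eq_zero]
  refine ⟨_, φ, σ.surjective.comp Ideal.Quotient.mk_surjective, ?_, hker⟩
  intro h
  rw [h, LinearMap.ker_zero] at hker
  exact hM.1.1 hker.symm

variable (R F N) in
/-- Pairs of a surjective ring homomorphism `ε : R → F` and a nonzero `ε`-semilinear map `N → F`. -/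
abbrev SimpleQuotientMaps : Type _ :=
  Σ ε : {ε : R →+* F // Function.Surjective ε}, {φ : N →ₛₗ[ε.1] F // φ ≠ 0}

/-- Changing a map onto a simple quotient by an automorphism of the field and a scaling. -/
noncomputable def SimpleQuotientMaps.twist (t : SimpleQuotientMaps R F N) (u : Fˣ)
    (σ : F ≃+* F) : SimpleQuotientMaps R F N :=
  ⟨⟨(σ : F →+* F).comp t.1.1, σ.surjective.comp t.1.2⟩,
    ⟨{ toFun := fun n => u * σ (t.2.1 n)
       map_add' := by intros; simp [mul_add]
       map_smul' := by intros; simp [mul_left_comm] }, by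
      intro h
      apply t.2.2
      ext n
      have h1 : (u : F) * σ (t.2.1 n) = 0 := LinearMap.congr_fun h n
      rwa [Units.mul_right_eq_zero, map_eq_zero_iff _ σ.injective] at h1⟩⟩

theorem SimpleQuotientMaps.ker_twist (t : SimpleQuotientMaps R F N) (u : Fˣ) (σ : F ≃+* F) :
    LinearMap.ker (t.twist u σ).2.1 = LinearMap.ker t.2.1 := by
  ext n
  rw [LinearMap.mem_ker, LinearMap.mem_ker]
  change (u : F) * σ (t.2.1 n) = 0 ↔ _
  rw [Units.mul_right_eq_zero, map_eq_zero_iff _ σ.injective]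

theorem SimpleQuotientMaps.ext_apply {t t' : SimpleQuotientMaps R F N}
    (h : ∀ n, t.2.1 n = t'.2.1 n) : t = t' := by
  obtain ⟨⟨ε, hε⟩, ⟨φ, hφ⟩⟩ := t
  obtain ⟨⟨ε', hε'⟩, ⟨φ', hφ'⟩⟩ := t'
  have : ε = ε' := by
    ext f
    -- The map determines `ε`: if `φ n = 1` then `ε f = φ (f • n)`.
    obtain ⟨n, hn⟩ := surjective_of_ne_zero hε hφ 1
    have h1 : φ (f • n) = φ' (f • n) := h (f • n)
    have h2 : φ n = φ' n := h n
    rw [map_smulₛₗ, map_smulₛₗ, ← h2, hn] at h1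
    simpa using h1
  subst this
  have : φ = φ' := LinearMap.ext h
  subst this
  rfl

theorem SimpleQuotientMaps.twist_injective (t : SimpleQuotientMaps R F N) {u u' : Fˣ}
    {σ σ' : F ≃+* F} (h : t.twist u σ = t.twist u' σ') : u = u' ∧ σ = σ' := by
  have key : ∀ y : F, (u : F) * σ y = u' * σ' y := by
    intro y
    obtain ⟨n, rfl⟩ := surjective_of_ne_zero t.1.2 t.2.2 y
    have : ∀ t₁ t₂ : SimpleQuotientMaps R F N, t₁ = t₂ → t₁.2.1 n = t₂.2.1 n := by
      rintro t₁ _ rfl; rfl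
    exact this _ _ h
  have hu : u = u' := Units.ext (by simpa using key 1)
  subst hu
  exact ⟨rfl, RingEquiv.ext fun y => mul_left_cancel₀ u.ne_zero (key y)⟩

/-- Equal kernels give an automorphism `σ` with `ε' = σ ∘ ε`. If `φ n = 1`, then `m - f • n` lies in
the kernel whenever `ε f = φ m`, whence `φ' m = φ' n * σ (φ m)`. -/
theorem SimpleQuotientMaps.exists_twist_eq [Finite F] (t t' : SimpleQuotientMaps R F N)
    (h : LinearMap.ker t.2.1 = LinearMap.ker t'.2.1) : ∃ u σ, t.twist u σ = t' := by
  obtain ⟨⟨ε, hε⟩, ⟨φ, hφ⟩⟩ := t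
  obtain ⟨⟨ε', hε'⟩, ⟨φ', hφ'⟩⟩ := t'
  change LinearMap.ker φ = LinearMap.ker φ' at h
  obtain ⟨n, hn⟩ := surjective_of_ne_zero hε hφ 1
  have hn' : φ' n ≠ 0 := by
    intro h0
    have : n ∈ LinearMap.ker φ := by rw [h]; exact h0
    rw [LinearMap.mem_ker, hn] at this
    exact one_ne_zero this
  have hker : ∀ f, ε f = 0 → ε' f = 0 := by
    intro f hf
    have h1 : f • n ∈ LinearMap.ker φ := by rw [LinearMap.mem_ker, map_smulₛₗ, hf, zero_smul]
    rw [h, LinearMap.mem_ker, map_smulₛₗ, smul_eq_mul, mul_eq_zero, or_iff_left hn'] at h1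
    exact h1
  let σ₀ : F →+* F := RingHom.liftOfSurjective ε hε ⟨ε', fun f hf => hker f hf⟩
  have hσ₀ : ∀ f, σ₀ (ε f) = ε' f := fun f => RingHom.liftOfRightInverse_comp_apply _ _ _ _ f
  let σ : F ≃+* F := RingEquiv.ofBijective σ₀ (Finite.injective_iff_bijective.1 σ₀.injective)
  refine ⟨Units.mk0 _ hn', σ, SimpleQuotientMaps.ext_apply fun m => ?_⟩
  change φ' n * σ₀ (φ m) = φ' m
  obtain ⟨f, hf⟩ := hε (φ m)
  have h1 : m - f • n ∈ LinearMap.ker φ := by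
    rw [LinearMap.mem_ker, map_sub, map_smulₛₗ, hf, hn]; simp
  rw [h, LinearMap.mem_ker, map_sub, map_smulₛₗ, sub_eq_zero] at h1
  rw [h1, ← hf, hσ₀, smul_eq_mul, mul_comm]

/-- Choosing one map per kernel, twisting by `Fˣ` and the automorphisms of `F` reaches each pair
exactly once. -/
theorem card_maxSubmodules_mul_eq [Finite F] :
    Nat.card (maxSubmodules R N (Nat.card F)) * (Nat.card Fˣ * Nat.card (F ≃+* F)) =
      Nat.card (SimpleQuotientMaps R F N) := by
  rw [← Nat.card_prod, ← Nat.card_prod]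
  have hex : ∀ M : maxSubmodules R N (Nat.card F),
      ∃ t : SimpleQuotientMaps R F N, LinearMap.ker t.2.1 = M.1 := by
    rintro ⟨M, hM⟩
    obtain ⟨ε, φ, h1, h2, h3⟩ := exists_ker_eq_of_mem_maxSubmodules hM
    exact ⟨⟨⟨ε, h1⟩, ⟨φ, h2⟩⟩, h3⟩
  choose t ht using hex
  refine Nat.card_congr (Equiv.ofBijective (fun w => (t w.1).twist w.2.1 w.2.2) ⟨?_, ?_⟩)
  · rintro ⟨M, u, σ⟩ ⟨M', u', σ'⟩ h
    simp only at h
    have hM : M = M' := by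
      apply Subtype.ext
      rw [← ht M, ← ht M', ← (t M).ker_twist u σ, h, (t M').ker_twist]
    subst hM
    obtain ⟨rfl, rfl⟩ := (t M).twist_injective h
    rfl
  · intro t'
    let M : maxSubmodules R N (Nat.card F) :=
      ⟨LinearMap.ker t'.2.1, isCoatom_ker t'.1.2 t'.2.2, index_ker t'.1.2 t'.2.2⟩
    obtain ⟨u, σ, h⟩ := (t M).exists_twist_eq t' (ht M)
    exact ⟨(M, u, σ), h⟩

end MaximalSubmodules

/-! ### From elementary divisors to invariant factors over a principal ideal domain. -/

section InvariantFactors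

variable {R : Type*} [CommRing R]

/-- Multiplication by `c` as a map `R/(a) → R/(b)`, when `b ∣ c * a`. -/
noncomputable def mulQuotSpan (a b c : R) (h : b ∣ c * a) :
    (R ⧸ Ideal.span {a}) →ₗ[R] R ⧸ Ideal.span {b} :=
  Submodule.mapQ _ _ (LinearMap.mulLeft R c) (by
    rw [Ideal.span, Submodule.span_singleton_le_iff_mem, Submodule.mem_comap]
    exact Ideal.mem_span_singleton.2 h)

/-- The isomorphism is the matrix with rows `(u, v)` and `(-b, a)`, of determinant `u * a + v * b =
1`. Its inverse has rows `(a, -v)` and `(b, u)`. -/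
theorem nonempty_quotient_prod_equiv (g a b u v : R) (h : u * a + v * b = 1) :
    Nonempty (((R ⧸ Ideal.span {g * a}) × (R ⧸ Ideal.span {g * b})) ≃ₗ[R]
      (R ⧸ Ideal.span {g}) × (R ⧸ Ideal.span {g * a * b})) := by
  let f : ((R ⧸ Ideal.span {g * a}) × (R ⧸ Ideal.span {g * b})) →ₗ[R]
      (R ⧸ Ideal.span {g}) × (R ⧸ Ideal.span {g * a * b}) :=
    LinearMap.prod
      (LinearMap.coprod (mulQuotSpan (g * a) g u ⟨u * a, by ring⟩)
        (mulQuotSpan (g * b) g v ⟨v * b, by ring⟩))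
      (LinearMap.coprod (mulQuotSpan (g * a) (g * a * b) (-b) ⟨-1, by ring⟩)
        (mulQuotSpan (g * b) (g * a * b) a ⟨1, by ring⟩))
  let f' : ((R ⧸ Ideal.span {g}) × (R ⧸ Ideal.span {g * a * b})) →ₗ[R]
      (R ⧸ Ideal.span {g * a}) × (R ⧸ Ideal.span {g * b}) :=
    LinearMap.prod
      (LinearMap.coprod (mulQuotSpan g (g * a) a ⟨1, by ring⟩)
        (mulQuotSpan (g * a * b) (g * a) (-v) ⟨-v * b, by ring⟩))
      (LinearMap.coprod (mulQuotSpan g (g * b) b ⟨1, by ring⟩)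
        (mulQuotSpan (g * a * b) (g * b) u ⟨u * a, by ring⟩))
  refine ⟨LinearEquiv.ofLinearMap f f' ?_ ?_⟩
  · refine LinearMap.ext ?_
    rintro ⟨x, y⟩
    obtain ⟨x, rfl⟩ := Ideal.Quotient.mk_surjective x
    obtain ⟨y, rfl⟩ := Ideal.Quotient.mk_surjective y
    refine Prod.ext ?_ ?_
    · change Ideal.Quotient.mk (Ideal.span {g}) (u * (a * x + -v * y) + v * (b * x + u * y)) = Ideal.Quotient.mk _ x
      congr 1
      linear_combination x * h
    · change Ideal.Quotient.mk (Ideal.span {g * a * b}) (-b * (a * x + -v * y) + a * (b * x + u * y)) = Ideal.Quotient.mk _ y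
      congr 1
      linear_combination y * h
  · refine LinearMap.ext ?_
    rintro ⟨x, y⟩
    obtain ⟨x, rfl⟩ := Ideal.Quotient.mk_surjective x
    obtain ⟨y, rfl⟩ := Ideal.Quotient.mk_surjective y
    refine Prod.ext ?_ ?_
    · change Ideal.Quotient.mk (Ideal.span {g * a}) (a * (u * x + v * y) + -v * (-b * x + a * y)) = Ideal.Quotient.mk _ x
      congr 1
      linear_combination x * h
    · change Ideal.Quotient.mk (Ideal.span {g * b}) (b * (u * x + v * y) + u * (-b * x + a * y)) = Ideal.Quotient.mk _ y
      congr 1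
      linear_combination y * h

/-- A family of moduli forms a divisibility chain of nonzero elements. -/
def IsDvdChain {n : ℕ} (a : Fin n → R) : Prop :=
  (∀ j, a j ≠ 0) ∧ ∀ i j, i ≤ j → a i ∣ a j

theorem IsDvdChain.cons {n : ℕ} {a : Fin n → R} (ha : IsDvdChain a) {b : R} (hb : b ≠ 0)
    (h : ∀ j, b ∣ a j) : IsDvdChain (Fin.cons b a : Fin (n + 1) → R) := by
  constructor
  · intro j
    refine Fin.cases ?_ (fun j => ?_) j
    · simpa using hb
    · simpa using ha.1 j
  · intro i j
    refine Fin.cases (fun _ => ?_) (fun i hij => ?_) i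
    · refine Fin.cases ?_ (fun j => ?_) j
      · simp
      · simpa using h j
    · obtain ⟨j, rfl⟩ := Fin.exists_succ_eq.2 (fun h0 : j = 0 => by simp [h0] at hij)
      simpa using ha.2 i j (Fin.succ_le_succ_iff.1 hij)

theorem IsDvdChain.tail {n : ℕ} {a : Fin (n + 1) → R} (ha : IsDvdChain a) :
    IsDvdChain (Fin.tail a) :=
  ⟨fun j => ha.1 j.succ, fun i j h => ha.2 i.succ j.succ (Fin.succ_le_succ_iff.2 h)⟩

theorem nonempty_pi_quotient_cons {n : ℕ} (b : R) (a : Fin n → R) :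
    Nonempty (((R ⧸ Ideal.span {b}) × Π j, R ⧸ Ideal.span {a j}) ≃ₗ[R]
      Π j, R ⧸ Ideal.span {(Fin.cons b a : Fin (n + 1) → R) j}) :=
  ⟨Fin.consLinearEquiv R fun j => R ⧸ Ideal.span {(Fin.cons b a : Fin (n + 1) → R) j}⟩

/-- Units in a divisibility chain form an initial segment, and their factors are zero modules. -/
theorem IsDvdChain.exists_not_isUnit (n : ℕ) : ∀ (a : Fin n → R), IsDvdChain a →
    ∃ (m : ℕ) (a' : Fin m → R), IsDvdChain a' ∧ (∀ j, ¬ IsUnit (a' j)) ∧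
      Nonempty ((Π j, R ⧸ Ideal.span {a j}) ≃ₗ[R] Π j, R ⧸ Ideal.span {a' j}) := by
  induction n with
  | zero => exact fun a ha => ⟨0, a, ha, fun i => i.elim0, ⟨LinearEquiv.refl R _⟩⟩
  | succ n ih =>
    intro a ha
    by_cases h : IsUnit (a 0)
    · obtain ⟨m, a', h1, h2, ⟨e⟩⟩ := ih (Fin.tail a) ha.tail
      obtain ⟨e2⟩ := nonempty_pi_quotient_cons (a 0) (Fin.tail a)
      rw [Fin.cons_self_tail] at e2
      have : Unique (R ⧸ Ideal.span {a 0}) := by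
        rw [Ideal.span_singleton_eq_top.2 h]
        exact Submodule.QuotientTop.unique
      exact ⟨m, a', h1, h2, ⟨(e2.symm.trans LinearEquiv.uniqueProd).trans e⟩⟩
    · exact ⟨n + 1, a, ha, fun j hj => h (isUnit_of_dvd_unit (ha.2 0 j (Fin.zero_le j)) hj),
        ⟨LinearEquiv.refl R _⟩⟩

variable [IsDomain R] [IsPrincipalIdealRing R]

theorem exists_gcd_bezout {a b : R} (ha : a ≠ 0) :
    ∃ g a' b' u v : R, a = g * a' ∧ b = g * b' ∧ u * a' + v * b' = 1 := by
  obtain ⟨g, hg⟩ := IsPrincipalIdealRing.principal (Ideal.span {a, b})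
  change Ideal.span {a, b} = Ideal.span {g} at hg
  obtain ⟨a', ha'⟩ := Ideal.mem_span_singleton.1 (hg ▸ Ideal.subset_span (by simp) :
    a ∈ Ideal.span {g})
  obtain ⟨b', hb'⟩ := Ideal.mem_span_singleton.1 (hg ▸ Ideal.subset_span (by simp) :
    b ∈ Ideal.span {g})
  obtain ⟨u, v, huv⟩ := Ideal.mem_span_pair.1 (hg ▸ Ideal.mem_span_singleton_self g :
    g ∈ Ideal.span {a, b})
  have hg0 : g ≠ 0 := by rintro rfl; simp [ha'] at ha
  refine ⟨g, a', b', u, v, ha', hb', mul_left_cancel₀ hg0 ?_⟩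
  calc g * (u * a' + v * b') = u * (g * a') + v * (g * b') := by ring
    _ = g * 1 := by rw [← ha', ← hb', huv, mul_one]

/-- Replace `a 0` and `b` by their gcd and lcm: the gcd stays in front, the lcm is inserted into the
tail. The clause on common divisors is carried through the induction so that the gcd divides the new
tail. -/
theorem exists_isDvdChain_insert (n : ℕ) : ∀ (a : Fin n → R) (b : R), IsDvdChain a → b ≠ 0 →
    ∃ a' : Fin (n + 1) → R, IsDvdChain a' ∧ (∀ c, c ∣ b → (∀ j, c ∣ a j) → ∀ j, c ∣ a' j) ∧
      Nonempty (((R ⧸ Ideal.span {b}) × Π j, R ⧸ Ideal.span {a j}) ≃ₗ[R]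
        Π j, R ⧸ Ideal.span {a' j}) := by
  induction n with
  | zero =>
    intro a b ha hb
    refine ⟨Fin.cons b a, ha.cons hb fun j => j.elim0, fun c hc _ j => ?_,
      nonempty_pi_quotient_cons b a⟩
    rw [Fin.fin_one_eq_zero j]
    simpa using hc
  | succ n ih =>
    intro a b ha hb
    obtain ⟨g, x, y, u, v, hx, hy, huv⟩ := exists_gcd_bezout (b := b) (ha.1 0)
    have hg : g ≠ 0 := by rintro rfl; simp [hy] at hb
    have hx0 : x ≠ 0 := by rintro rfl; exact ha.1 0 (by simp [hx])
    have hy0 : y ≠ 0 := by rintro rfl; exact hb (by simp [hy])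
    obtain ⟨a', h1, h2, ⟨e⟩⟩ := ih (Fin.tail a) (g * x * y) ha.tail
      (mul_ne_zero (mul_ne_zero hg hx0) hy0)
    have hdvd : ∀ j, g ∣ a j := fun j => (Dvd.intro x hx.symm).trans (ha.2 0 j (Fin.zero_le j))
    obtain ⟨e1⟩ := nonempty_quotient_prod_equiv g x y u v huv
    obtain ⟨e2⟩ := nonempty_pi_quotient_cons (a 0) (Fin.tail a)
    rw [Fin.cons_self_tail] at e2
    obtain ⟨e3⟩ := nonempty_pi_quotient_cons g a'
    refine ⟨Fin.cons g a', h1.cons hg (h2 g ⟨x * y, by ring⟩ fun j => hdvd j.succ), ?_, ?_⟩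
    · intro c hcb hca j
      have hcg : c ∣ g := by
        have : g = u * a 0 + v * b := by rw [hx, hy]; linear_combination (-g) * huv
        rw [this]
        exact dvd_add ((hca 0).mul_left u) (hcb.mul_left v)
      refine Fin.cases ?_ (fun j => ?_) j
      · simpa using hcg
      · simpa using h2 c ((hcg.mul_right x).mul_right y) (fun j => hca j.succ) j
    · rw [hx] at e2
      rw [hy]
      exact ⟨(LinearEquiv.prodCongr (LinearEquiv.refl R _) e2.symm).trans <|
        (LinearEquiv.prodAssoc R _ _ _).symm.trans <|
        (LinearEquiv.prodCongr ((LinearEquiv.prodComm R _ _).trans e1)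
          (LinearEquiv.refl R _)).trans <|
        (LinearEquiv.prodAssoc R _ _ _).trans <|
        (LinearEquiv.prodCongr (LinearEquiv.refl R _) e).trans e3⟩

theorem exists_isDvdChain (n : ℕ) : ∀ (b : Fin n → R), (∀ j, b j ≠ 0) →
    ∃ a : Fin n → R, IsDvdChain a ∧
      Nonempty ((Π j, R ⧸ Ideal.span {b j}) ≃ₗ[R] Π j, R ⧸ Ideal.span {a j}) := by
  induction n with
  | zero => exact fun b hb => ⟨b, ⟨hb, fun i => i.elim0⟩, ⟨LinearEquiv.refl R _⟩⟩
  | succ n ih =>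
    intro b hb
    obtain ⟨a, ha, ⟨e⟩⟩ := ih (Fin.tail b) fun j => hb j.succ
    obtain ⟨a', ha', -, ⟨e'⟩⟩ := exists_isDvdChain_insert n a (b 0) ha (hb 0)
    obtain ⟨e2⟩ := nonempty_pi_quotient_cons (b 0) (Fin.tail b)
    rw [Fin.cons_self_tail] at e2
    exact ⟨a', ha', ⟨e2.symm.trans
      ((LinearEquiv.prodCongr (LinearEquiv.refl R _) e).trans e')⟩⟩

/-- The invariant factor form of the structure theorem over a principal ideal domain. -/
theorem exists_invariantFactors (M : Type*) [AddCommGroup M] [Module R M] [Module.Finite R M] :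
    ∃ (s r : ℕ) (a : Fin s → R), (∀ j, a j ≠ 0 ∧ ¬ IsUnit (a j)) ∧ (∀ i j, i ≤ j → a i ∣ a j) ∧
      Nonempty (M ≃ₗ[R] (Π j, R ⧸ Ideal.span {a j}) × (Fin r → R)) := by
  classical
  obtain ⟨r, ι, _, p, hp, k, ⟨e⟩⟩ := Module.equiv_free_prod_directSum (R := R) (M := M)
  let σ := Fintype.equivFin ι
  obtain ⟨a, ha, ⟨e1⟩⟩ := exists_isDvdChain _ (fun j => p (σ.symm j) ^ k (σ.symm j))
    fun j => pow_ne_zero _ (hp _).ne_zero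
  obtain ⟨s, a', ha', hu, ⟨e2⟩⟩ := ha.exists_not_isUnit
  refine ⟨s, r, a', fun j => ⟨ha'.1 j, hu j⟩, ha'.2, ⟨?_⟩⟩
  let e3 := DirectSum.linearEquivFunOnFintype R ι fun i => R ⧸ Ideal.span {p i ^ k i}
  let e4 := LinearEquiv.piCongrLeft' R (fun i => R ⧸ Ideal.span {p i ^ k i}) σ
  exact e.trans <| (LinearEquiv.prodComm R _ _).trans <|
    LinearEquiv.prodCongr (e3.trans <| e4.trans <| e1.trans e2)
      (Finsupp.linearEquivFunOnFinite R R (Fin r))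

end InvariantFactors

/-! ### One scalar killing a kernel and a cokernel. -/

/-- Elements of a finitely generated submodule that can be moved one by one into `L` by elements
of `S` can be moved into `L` simultaneously. -/
theorem Submodule.FG.exists_smul_mem {R P : Type*} [CommRing R] [AddCommGroup P] [Module R P]
    {K : Submodule R P} (hK : K.FG) (L : Submodule R P) (S : Submonoid R)
    (h : ∀ y ∈ K, ∃ s ∈ S, s • y ∈ L) : ∃ s ∈ S, ∀ y ∈ K, s • y ∈ L := by
  classical
  obtain ⟨t, rfl⟩ := hK
  have h' : ∀ y : t, ∃ s ∈ S, s • (y : P) ∈ L := fun y => h y (Submodule.subset_span y.2)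
  choose s hs hsL using h'
  refine ⟨∏ y, s y, S.prod_mem fun y _ => hs y, fun y hy => ?_⟩
  have : Submodule.span R (t : Set P) ≤ L.comap (LinearMap.lsmul R P (∏ y, s y)) := by
    rw [Submodule.span_le]
    intro y hy
    obtain ⟨c, hc⟩ := Finset.dvd_prod_of_mem s (Finset.mem_univ (⟨y, hy⟩ : t))
    change (∏ y, s y) • y ∈ L
    rw [hc, mul_comm, mul_smul]
    exact L.smul_mem c (hsL ⟨y, hy⟩)
  exact this hy

/-- The kernel is finitely generated because `R` is Noetherian, so elementwise annihilators in `S`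
multiply to a common one. -/
theorem exists_common_smul {R P N : Type*} [CommRing R] [IsNoetherianRing R] [AddCommGroup P]
    [Module R P] [Module.Finite R P] [AddCommGroup N] [Module R N] [Module.Finite R N]
    (v : P →ₗ[R] N) (S : Submonoid R) (hker : ∀ y, v y = 0 → ∃ s ∈ S, s • y = 0)
    (hrange : ∀ n, ∃ s ∈ S, ∃ y, v y = s • n) :
    ∃ s ∈ S, (∀ y, v y = 0 → s • y = 0) ∧ ∀ n, ∃ y, v y = s • n := by
  obtain ⟨s, hs, h1⟩ := (IsNoetherian.noetherian (LinearMap.ker v)).exists_smul_mem ⊥ S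
    (by simpa using hker)
  obtain ⟨t, ht, h2⟩ := (Module.Finite.fg_top (R := R) (M := N)).exists_smul_mem
    (LinearMap.range v) S (by simpa using hrange)
  refine ⟨s * t, S.mul_mem hs ht, fun y hy => ?_, fun n => ?_⟩
  · rw [mul_comm, mul_smul, (Submodule.mem_bot R).1 (h1 y hy), smul_zero]
  · obtain ⟨y, hy⟩ := h2 n trivial
    exact ⟨s • y, by rw [map_smul, hy, mul_smul]⟩

/-! ### The rational module `ℚN` and clearing denominators. -/

section RatModule

universe u

variable (N : Type u) [AddCommGroup N] [Module ℤ[X] N]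

/-- The canonical map `N → ℚN`. -/
noncomputable def toRatModule : N →ₛₗ[mapRingHom (Int.castRingHom ℚ)] RatModule N where
  toFun n := Module.AEval'.of _ ((1 : ℚ) ⊗ₜ[ℤ] n)
  map_add' a b := by rw [TensorProduct.tmul_add, map_add]
  map_smul' f n := by
    induction f using Polynomial.induction_on' with
    | add p q hp hq => rw [add_smul, TensorProduct.tmul_add, map_add, hp, hq, map_add, add_smul]
    | monomial k a =>
      rw [← C_mul_X_pow_eq_monomial]
      induction k generalizing n with
      | zero =>
        simp only [pow_zero, mul_one, coe_mapRingHom, map_C]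
        rw [Module.AEval.C_smul, ← map_smul, TensorProduct.smul_tmul']
        simp only [eq_intCast, Int.cast_smul_eq_zsmul, smul_eq_mul, mul_one]
        rw [← TensorProduct.smul_tmul a (1 : ℚ) n, zsmul_one]
      | succ k ih =>
        rw [pow_succ, ← mul_assoc, mul_smul, ih,
          map_mul (mapRingHom (Int.castRingHom ℚ)) (C a * X ^ k) X, mul_smul]
        congr 1
        simp only [coe_mapRingHom, map_X]
        rw [Module.AEval.X_smul_of]
        rfl

theorem exists_toRatModule_eq (z : RatModule N) :
    ∃ (m : ℤ) (n : N), m ≠ 0 ∧ (m : ℚ[X]) • z = toRatModule N n := by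
  obtain ⟨z, rfl⟩ := (Module.AEval'.of ((mulX N).baseChange ℚ)).surjective z
  induction z using TensorProduct.induction_on with
  | zero => exact ⟨1, 0, one_ne_zero, by simp⟩
  | tmul q n =>
    refine ⟨q.den, q.num • n, by exact_mod_cast q.den_ne_zero, ?_⟩
    change _ = Module.AEval'.of _ ((1 : ℚ) ⊗ₜ[ℤ] (q.num • n))
    rw [← TensorProduct.smul_tmul, Int.cast_smul_eq_zsmul, ← map_zsmul, TensorProduct.smul_tmul']
    congr 2
    simp [mul_comm]
  | add z w hz hw =>
    obtain ⟨m, n, hm, h⟩ := hz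
    obtain ⟨m', n', hm', h'⟩ := hw
    refine ⟨m * m', (m' : ℤ[X]) • n + (m : ℤ[X]) • n', mul_ne_zero hm hm', ?_⟩
    simp only [map_add, map_smulₛₗ, smul_add, ← h, ← h', ← mul_smul, map_intCast, Int.cast_mul]
    rw [mul_comm]

theorem exists_smul_eq_zero_of_toRatModule {n : N} (h : toRatModule N n = 0) :
    ∃ m : ℤ, m ≠ 0 ∧ (m : ℤ[X]) • n = 0 := by
  have h1 : TensorProduct.mk ℤ ℚ N 1 n = 0 := (Module.AEval'.of _).map_eq_zero_iff.1 h
  have : IsLocalizedModule (nonZeroDivisors ℤ) (TensorProduct.mk ℤ ℚ N 1) :=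
    (isLocalizedModule_iff_isBaseChange (nonZeroDivisors ℤ) ℚ _).2 (TensorProduct.isBaseChange _ _ _)
  obtain ⟨⟨m, hm⟩, h2⟩ := (IsLocalizedModule.eq_zero_iff (nonZeroDivisors ℤ) _).1 h1
  exact ⟨m, nonZeroDivisors.ne_zero hm, by rw [Int.cast_smul_eq_zsmul]; exact h2⟩

instance RatModule.instFinite [Module.Finite ℤ[X] N] : Module.Finite ℚ[X] (RatModule N) := by
  classical
  obtain ⟨s, hs⟩ := Module.Finite.fg_top (R := ℤ[X]) (M := N)
  refine ⟨⟨s.image (toRatModule N), ?_⟩⟩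
  have key : ∀ n, toRatModule N n ∈ Submodule.span ℚ[X] (s.image (toRatModule N) : Set _) := by
    intro n
    have hn : n ∈ Submodule.span ℤ[X] (s : Set N) := hs ▸ trivial
    induction hn using Submodule.span_induction with
    | mem x hx => exact Submodule.subset_span (by simpa using ⟨x, hx, rfl⟩)
    | zero => rw [map_zero]; exact Submodule.zero_mem _
    | add x y _ _ hx hy => rw [map_add]; exact Submodule.add_mem _ hx hy
    | smul f x _ hx => rw [map_smulₛₗ]; exact Submodule.smul_mem _ _ hx
  rw [eq_top_iff]
  intro z _
  obtain ⟨m, n, hm, h⟩ := exists_toRatModule_eq N z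
  have : z = C ((m : ℚ)⁻¹) • ((m : ℚ[X]) • z) := by
    rw [← mul_smul, ← map_intCast (C : ℚ →+* ℚ[X]), ← C_mul, inv_mul_cancel₀ (by exact_mod_cast hm), C_1, one_smul]
  rw [this, h]
  exact Submodule.smul_mem _ _ (key n)

theorem exists_hasInvariantFactorForm [Module.Finite ℤ[X] N] :
    ∃ s r, HasInvariantFactorForm N s r := by
  obtain ⟨s, r, a, h1, h2, h3⟩ := exists_invariantFactors (R := ℚ[X]) (RatModule N)
  exact ⟨s, r, a, h1, h2, h3⟩

end RatModule

theorem Ideal.Quotient.smul_mk' {R : Type*} [CommRing R] (I : Ideal R) (x f : R) :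
    x • Ideal.Quotient.mk I f = Ideal.Quotient.mk I (x * f) := rfl

theorem Ideal.Quotient.smul_one' {R : Type*} [CommRing R] (I : Ideal R) (x : R) :
    x • (1 : R ⧸ I) = Ideal.Quotient.mk I x := by
  rw [← map_one (Ideal.Quotient.mk I), Ideal.Quotient.smul_mk', mul_one]

theorem exists_intPolynomial_map_eq (a : ℚ[X]) :
    ∃ (m : ℤ) (b : ℤ[X]), m ≠ 0 ∧ b.map (Int.castRingHom ℚ) = (m : ℚ[X]) * a := by
  obtain ⟨m, hm, h⟩ := IsLocalization.integerNormalization_spec (nonZeroDivisors ℤ) a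
  refine ⟨m, _, nonZeroDivisors.ne_zero hm, h.trans ?_⟩
  change m • a = _
  rw [zsmul_eq_mul]

/-- Divisibility over `ℚ` becomes divisibility over `ℤ` after multiplication by an integer. -/
theorem exists_dvd_intCast_mul {f g : ℤ[X]}
    (h : f.map (Int.castRingHom ℚ) ∣ g.map (Int.castRingHom ℚ)) :
    ∃ m : ℤ, m ≠ 0 ∧ f ∣ (m : ℤ[X]) * g := by
  obtain ⟨t, ht⟩ := h
  obtain ⟨m, t', hm, ht'⟩ := exists_intPolynomial_map_eq t
  refine ⟨m, hm, t', map_injective (Int.castRingHom ℚ) Int.cast_injective ?_⟩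
  rw [Polynomial.map_mul, Polynomial.map_mul, ht', ht, Polynomial.map_intCast]
  ring

/-! ### Spreading the decomposition of `ℚN` out over the integers. -/

section Spreading

universe u

variable {N : Type u} [AddCommGroup N] [Module ℤ[X] N]

theorem isUnit_intCast_ratPolynomial {m : ℤ} (hm : m ≠ 0) : IsUnit (m : ℚ[X]) := by
  rw [← map_intCast (C : ℚ →+* ℚ[X]), isUnit_C, isUnit_iff_ne_zero]
  exact_mod_cast hm

variable {ι : Type*} [Fintype ι] {a : ι → ℚ[X]} {b : ι → ℤ[X]}

/-- The integral model of a cyclic decomposition of `ℚN`: the coordinates of `ρ(v(f))`. -/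
theorem exists_map_of_ratModule_equiv [DecidableEq ι]
    (e : RatModule N ≃ₗ[ℚ[X]] Π i, ℚ[X] ⧸ Ideal.span {a i})
    (hab : ∀ i, a i ∣ (b i).map (Int.castRingHom ℚ)) :
    ∃ (v : (Π i, ℤ[X] ⧸ Ideal.span {b i}) →ₗ[ℤ[X]] N) (μ : ι → ℤ), (∀ i, μ i ≠ 0) ∧
      ∀ (f : ι → ℤ[X]) (i : ι), e (toRatModule N (v fun j => Ideal.Quotient.mk _ (f j))) i =
        Ideal.Quotient.mk _ ((μ i : ℚ[X]) * (f i).map (Int.castRingHom ℚ)) := by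
  have key : ∀ i, ∃ (μ : ℤ) (n : N), μ ≠ 0 ∧ b i • n = 0 ∧
      toRatModule N n = (μ : ℚ[X]) • e.symm (Pi.single i 1) := by
    intro i
    obtain ⟨m, n, hm, hn⟩ := exists_toRatModule_eq N (e.symm (Pi.single i 1))
    have h0 : toRatModule N (b i • n) = 0 := by
      rw [map_smulₛₗ, ← hn, ← map_smul, ← map_smul, ← Pi.single_smul, ← Pi.single_smul]
      have : (mapRingHom (Int.castRingHom ℚ)) (b i) •
          (m : ℚ[X]) • (1 : ℚ[X] ⧸ Ideal.span {a i}) = 0 := by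
        rw [smul_comm]
        have : (mapRingHom (Int.castRingHom ℚ)) (b i) • (1 : ℚ[X] ⧸ Ideal.span {a i}) = 0 := by
          rw [Ideal.Quotient.smul_one']
          exact Ideal.Quotient.eq_zero_iff_mem.2 (Ideal.mem_span_singleton.2 (hab i))
        rw [this, smul_zero]
      rw [this, Pi.single_zero, map_zero]
    obtain ⟨m', hm', h1⟩ := exists_smul_eq_zero_of_toRatModule N h0
    -- `m` makes the generator integral, and `m'` removes the torsion that keeps `b i` from killing
    -- it.
    refine ⟨m' * m, (m' : ℤ[X]) • n, mul_ne_zero hm' hm, by rw [smul_comm, h1], ?_⟩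
    rw [map_smulₛₗ, ← hn, map_intCast, Int.cast_mul, mul_smul]
  choose μ n hμ hbn hρ using key
  refine ⟨∑ i, (Submodule.liftQ (Ideal.span {b i}) (LinearMap.toSpanSingleton ℤ[X] N (n i)) (by
      rw [Ideal.span, Submodule.span_singleton_le_iff_mem, LinearMap.mem_ker]
      exact hbn i)).comp
      (LinearMap.proj (R := ℤ[X]) (φ := fun i => ℤ[X] ⧸ Ideal.span {b i}) i), μ, hμ, ?_⟩
  intro f i
  have h1 : ∀ (j : ι), (Submodule.liftQ (Ideal.span {b j})
      (LinearMap.toSpanSingleton ℤ[X] N (n j)) (by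
      rw [Ideal.span, Submodule.span_singleton_le_iff_mem, LinearMap.mem_ker]
      exact hbn j)) (Ideal.Quotient.mk _ (f j)) = f j • n j := fun j => rfl
  simp only [LinearMap.sum_apply, LinearMap.comp_apply, LinearMap.proj_apply, h1, map_sum,
    map_smulₛₗ, hρ, LinearEquiv.apply_symm_apply, Finset.sum_apply, RingHom.id_apply]
  rw [Finset.sum_eq_single i]
  · rw [Pi.smul_apply, Pi.smul_apply, Pi.single_eq_same, ← mul_smul, Ideal.Quotient.smul_one',
      mul_comm]
    rfl
  · intro j _ hj
    rw [Pi.smul_apply, Pi.smul_apply, Pi.single_eq_of_ne (Ne.symm hj), smul_zero, smul_zero]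
  · simp

/-- The map `v` becomes an isomorphism over `ℚ`, so its kernel and cokernel are torsion over `ℤ`; by
finite generation one integer kills both. Maps to a field in which `m ≠ 0` then do not distinguish
`N` from a product of cyclic modules. -/
theorem exists_spreading_out [Module.Finite ℤ[X] N]
    (e : RatModule N ≃ₗ[ℚ[X]] Π i, ℚ[X] ⧸ Ideal.span {a i}) (c : ι → ℤ) (hc : ∀ i, c i ≠ 0)
    (hb : ∀ i, (b i).map (Int.castRingHom ℚ) = (c i : ℚ[X]) * a i) :
    ∃ (v : (Π i, ℤ[X] ⧸ Ideal.span {b i}) →ₗ[ℤ[X]] N) (m : ℤ), m ≠ 0 ∧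
      (∀ y, v y = 0 → (m : ℤ[X]) • y = 0) ∧ ∀ n, ∃ y, v y = (m : ℤ[X]) • n := by
  classical
  obtain ⟨v, μ, hμ, hv⟩ := exists_map_of_ratModule_equiv (b := b) e fun i => by
    rw [hb]; exact dvd_mul_left _ _
  let S : Submonoid ℤ[X] := (nonZeroDivisors ℤ).map (Int.castRingHom ℤ[X])
  have hS : ∀ m : ℤ, m ≠ 0 → (m : ℤ[X]) ∈ S := fun m hm =>
    ⟨m, mem_nonZeroDivisors_of_ne_zero hm, rfl⟩
  suffices h : ∃ s ∈ S, (∀ y, v y = 0 → s • y = 0) ∧ ∀ n, ∃ y, v y = s • n by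
    obtain ⟨s, ⟨m, hm, rfl⟩, h1⟩ := h
    exact ⟨v, m, nonZeroDivisors.ne_zero hm, h1⟩
  refine exists_common_smul v S (fun y hy => ?_) fun n => ?_
  · choose f hf using fun i => Ideal.Quotient.mk_surjective (I := Ideal.span {b i}) (y i)
    obtain rfl : (fun i => Ideal.Quotient.mk _ (f i)) = y := funext hf
    have h1 : ∀ i, ∃ k : ℤ, k ≠ 0 ∧ b i ∣ (k : ℤ[X]) * f i := by
      intro i
      have h2 := hv f i
      rw [hy, map_zero, map_zero, Pi.zero_apply] at h2
      have h3 := Ideal.mem_span_singleton.1 (Ideal.Quotient.eq_zero_iff_mem.1 h2.symm)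
      have h4 : (b i).map (Int.castRingHom ℚ) ∣ (f i).map (Int.castRingHom ℚ) := by
        rw [hb, (isUnit_intCast_ratPolynomial (hc i)).mul_left_dvd]
        exact ((isUnit_intCast_ratPolynomial (hμ i)).dvd_mul_left).1 h3
      exact exists_dvd_intCast_mul h4
    choose k hk0 hk using h1
    refine ⟨_, hS (∏ i, k i) (Finset.prod_ne_zero_iff.2 fun i _ => hk0 i), funext fun i => ?_⟩
    obtain ⟨l, hl⟩ := Finset.dvd_prod_of_mem k (Finset.mem_univ i)
    rw [Pi.smul_apply, Pi.zero_apply, Ideal.Quotient.smul_mk']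
    rw [Ideal.Quotient.eq_zero_iff_mem, Ideal.mem_span_singleton, hl, Int.cast_mul,
      mul_right_comm]
    exact (hk i).mul_right _
  · choose q hq using fun i =>
      Ideal.Quotient.mk_surjective (I := Ideal.span {a i}) (e (toRatModule N n) i)
    choose κ t hκ ht using fun i => exists_intPolynomial_map_eq (q i)
    -- `κ i` clears the denominators of the `i`-th coordinate of `n`, and `μ i` is the multiplier
    -- built into `v`.
    let K : ℤ := ∏ i, κ i * μ i
    have hK : K ≠ 0 := Finset.prod_ne_zero_iff.2 fun i _ => mul_ne_zero (hκ i) (hμ i)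
    choose l hl using fun i => Finset.dvd_prod_of_mem (fun i => κ i * μ i) (Finset.mem_univ i)
    have h1 : toRatModule N ((K : ℤ[X]) • n -
        v fun i => Ideal.Quotient.mk _ ((l i : ℤ[X]) * t i)) = 0 := by
      rw [map_sub, sub_eq_zero]
      apply e.injective
      funext i
      rw [hv, map_smulₛₗ, map_smul, Pi.smul_apply, ← hq, map_intCast, Polynomial.map_mul, ht,
        Polynomial.map_intCast, Ideal.Quotient.smul_mk']
      have : (K : ℚ[X]) = κ i * μ i * l i := by
        rw [show K = κ i * μ i * l i from hl i]; push_cast; rfl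
      rw [this]
      congr 1
      ring
    obtain ⟨m, hm, h2⟩ := exists_smul_eq_zero_of_toRatModule N h1
    refine ⟨_, hS (m * K) (mul_ne_zero hm hK),
      (m : ℤ[X]) • fun i => Ideal.Quotient.mk _ ((l i : ℤ[X]) * t i), ?_⟩
    rw [smul_sub, sub_eq_zero] at h2
    rw [map_smul, ← h2, Int.cast_mul, mul_smul]

end Spreading

/-! ### A free module approximating a module over a Noetherian domain. -/

section Rank

theorem exists_injective_finFun_of_isDomain {R N : Type*} [CommRing R] [IsDomain R]
    [IsNoetherianRing R] [AddCommGroup N] [Module R N] [Module.Finite R N] :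
    ∃ (v : (Fin (Module.finrank R N) → R) →ₗ[R] N) (c : R), c ≠ 0 ∧
      (∀ y, v y = 0 → c • y = 0) ∧ ∀ n, ∃ y, v y = c • n := by
  obtain ⟨w, hw⟩ : ∃ w : Fin (Module.finrank R N) → N, LinearIndependent R w :=
    exists_linearIndependent_of_le_finrank le_rfl
  suffices h : ∃ s ∈ nonZeroDivisors R, (∀ y, Fintype.linearCombination R w y = 0 → s • y = 0) ∧
      ∀ n, ∃ y, Fintype.linearCombination R w y = s • n by
    obtain ⟨s, hs, h⟩ := h
    exact ⟨_, s, nonZeroDivisors.ne_zero hs, h⟩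
  refine exists_common_smul _ _ (fun y hy => ⟨1, one_mem _, ?_⟩) fun n => ?_
  · rw [one_smul]
    exact (injective_iff_map_eq_zero _).1 (LinearIndependent.fintypeLinearCombination_injective hw) y hy
  · by_contra! hn
    -- If no nonzero multiple of `n` lay in the span of `w`, adjoining `n` would give more
    -- independent elements than the rank allows.
    have h2 : LinearIndependent R (Fin.cons n w : Fin (Module.finrank R N + 1) → N) := by
      rw [Fintype.linearIndependent_iff]
      intro g hg
      rw [Fin.sum_univ_succ] at hg
      simp only [Fin.cons_zero, Fin.cons_succ] at hg
      have h0 : g 0 = 0 := by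
        by_contra h0
        refine hn (g 0) (mem_nonZeroDivisors_of_ne_zero h0) (fun i => - g i.succ) ?_
        rw [Fintype.linearCombination_apply, eq_comm, ← add_eq_zero_iff_eq_neg.1 hg |>.symm]
        simp
      rw [h0, zero_smul, zero_add] at hg
      have h3 := Fintype.linearIndependent_iff.1 hw _ hg
      exact fun i => Fin.cases h0 h3 i
    have := h2.fintype_card_le_finrank
    simp at this

end Rank

/-! ### Reduction modulo `p`. -/

section ModP

universe u

variable (N : Type u) [AddCommGroup N] [Module ℤ[X] N] (p : ℕ)

/-- The canonical map `N → N/pN`. -/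
noncomputable def toModPModule :
    N →ₛₗ[mapRingHom (Int.castRingHom (ZMod p))] ModPModule N p where
  toFun n := Module.AEval'.of _ (Submodule.Quotient.mk n : QuotModP N p)
  map_add' a b := by rw [Submodule.Quotient.mk_add, map_add]
  map_smul' f n := by
    induction f using Polynomial.induction_on' with
    | add f g hf hg =>
      rw [add_smul, Submodule.Quotient.mk_add, map_add, hf, hg, map_add, add_smul]
    | monomial k a =>
      rw [← C_mul_X_pow_eq_monomial]
      induction k generalizing n with
      | zero =>
        simp only [pow_zero, mul_one, coe_mapRingHom, map_C]
        rw [Module.AEval.C_smul, ← map_smul]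
        simp only [eq_intCast, Int.cast_smul_eq_zsmul]
        rw [← Submodule.Quotient.mk_smul]
      | succ k ih =>
        rw [pow_succ, ← mul_assoc, mul_smul, ih,
          map_mul (mapRingHom (Int.castRingHom (ZMod p))) (C a * X ^ k) X, mul_smul]
        congr 1
        simp only [coe_mapRingHom, map_X]
        rw [Module.AEval.X_smul_of]
        rfl

theorem toModPModule_surjective : Function.Surjective (toModPModule N p) := by
  intro z
  obtain ⟨z, rfl⟩ := (Module.AEval'.of ((mulX (QuotModP N p)).toAddMonoidHom.toZModLinearMap
    p)).surjective z
  obtain ⟨n, rfl⟩ := Submodule.Quotient.mk_surjective _ z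
  exact ⟨n, rfl⟩

theorem exists_eq_smul_of_toModPModule {n : N} (h : toModPModule N p n = 0) :
    ∃ m : N, n = (p : ℤ[X]) • m := by
  have h1 : (Submodule.Quotient.mk n : QuotModP N p) = 0 :=
    (Module.AEval'.of ((mulX (QuotModP N p)).toAddMonoidHom.toZModLinearMap p)).injective
      (h.trans (map_zero _).symm)
  rw [Submodule.Quotient.mk_eq_zero, Submodule.ideal_span_singleton_smul,
    Submodule.mem_smul_pointwise_iff_exists] at h1
  obtain ⟨m, -, hm⟩ := h1
  exact ⟨m, hm.symm⟩

instance ModPModule.instFinite [Module.Finite ℤ[X] N] :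
    Module.Finite (ZMod p)[X] (ModPModule N p) := by
  classical
  obtain ⟨s, hs⟩ := Module.Finite.fg_top (R := ℤ[X]) (M := N)
  refine ⟨⟨s.image (toModPModule N p), ?_⟩⟩
  rw [eq_top_iff]
  intro z _
  obtain ⟨n, rfl⟩ := toModPModule_surjective N p z
  have hn : n ∈ Submodule.span ℤ[X] (s : Set N) := hs ▸ trivial
  induction hn using Submodule.span_induction with
  | mem x hx => exact Submodule.subset_span (by simpa using ⟨x, hx, rfl⟩)
  | zero => rw [map_zero]; exact Submodule.zero_mem _
  | add x y _ _ hx hy => rw [map_add]; exact Submodule.add_mem _ (hx trivial) (hy trivial)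
  | smul f x _ hx => rw [map_smulₛₗ]; exact Submodule.smul_mem _ _ (hx trivial)

variable {F : Type*} [Field F]

/-- Maps to a field of characteristic `p` kill `pN`. -/
theorem card_semilinearMap_modPModule [CharP F p] (ε : (ZMod p)[X] →+* F) :
    Nat.card (N →ₛₗ[ε.comp (mapRingHom (Int.castRingHom (ZMod p)))] F) =
      Nat.card (ModPModule N p →ₛₗ[ε] F) := by
  have : RingHomCompTriple (mapRingHom (Int.castRingHom (ZMod p))) ε
    (ε.comp (mapRingHom (Int.castRingHom (ZMod p)))) := ⟨rfl⟩
  symm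
  refine Nat.card_congr (Equiv.ofBijective (fun ψ => ψ.comp (toModPModule N p)) ⟨?_, ?_⟩)
  · intro ψ ψ' h
    refine LinearMap.ext fun z => ?_
    obtain ⟨n, rfl⟩ := toModPModule_surjective N p z
    exact LinearMap.congr_fun h n
  · intro φ
    have key : ∀ a b, toModPModule N p a = toModPModule N p b → φ a = φ b := by
      intro a b h
      rw [← sub_eq_zero, ← map_sub] at h ⊢
      obtain ⟨m, hm⟩ := exists_eq_smul_of_toModPModule N p h
      rw [hm, map_smulₛₗ, map_natCast, CharP.cast_eq_zero, zero_smul]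
    choose g hg using toModPModule_surjective N p
    refine ⟨{ toFun := fun z => φ (g z), map_add' := ?_, map_smul' := ?_ }, ?_⟩
    · intro a b
      rw [← map_add]
      exact key _ _ (by rw [map_add, hg, hg, hg])
    · intro f a
      obtain ⟨f, rfl⟩ := map_surjective (Int.castRingHom (ZMod p)) ZMod.intCast_surjective f
      rw [← coe_mapRingHom, key (g ((mapRingHom (Int.castRingHom (ZMod p))) f • a)) (f • g a)
        (by rw [map_smulₛₗ, hg, hg]), map_smulₛₗ]
      rfl
    · ext n
      exact key _ _ (hg _)

end ModP

/-! ### Generators of finite fields. -/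

section FiniteField

variable (p : ℕ) [Fact p.Prime] {F : Type*} [Field F] [Algebra (ZMod p) F]

theorem aeval_int_eq (α : F) (f : ℤ[X]) :
    aeval α f = aeval α (f.map (Int.castRingHom (ZMod p))) := by
  rw [aeval_def, aeval_def, eval₂_map]
  congr 1
  exact RingHom.ext_int _ _

theorem surjective_aeval_int_iff [Finite F] (α : F) :
    Function.Surjective (aeval α : ℤ[X] →ₐ[ℤ] F) ↔ IntermediateField.adjoin (ZMod p) {α} = ⊤ := by
  have h1 : Function.Surjective (aeval α : ℤ[X] →ₐ[ℤ] F) ↔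
      Function.Surjective (aeval α : (ZMod p)[X] →ₐ[ZMod p] F) := by
    constructor
    · intro h y
      obtain ⟨f, rfl⟩ := h y
      exact ⟨_, (aeval_int_eq p α f).symm⟩
    · intro h y
      obtain ⟨f, rfl⟩ := h y
      obtain ⟨f, rfl⟩ := map_surjective (Int.castRingHom (ZMod p)) ZMod.intCast_surjective f
      exact ⟨f, aeval_int_eq p α f⟩
  have hint : IsIntegral (ZMod p) α := Algebra.IsIntegral.isIntegral α
  rw [h1, ← AlgHom.range_eq_top, ← Algebra.adjoin_singleton_eq_range_aeval,
    ← IntermediateField.adjoin_simple_toSubalgebra_of_isAlgebraic hint.isAlgebraic,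
    ← IntermediateField.top_toSubalgebra, IntermediateField.toSubalgebra_inj]

theorem natCard_eq_pow_finrank [Finite F] :
    Nat.card F = p ^ Module.finrank (ZMod p) F := by
  rw [Module.natCard_eq_pow_finrank (K := ZMod p), Nat.card_zmod]

theorem natCard_ringAut [Finite F] : Nat.card (F ≃+* F) = Module.finrank (ZMod p) F := by
  rw [← IsGalois.card_aut_eq_finrank]
  refine Nat.card_congr
    { toFun := fun σ => AlgEquiv.ofRingEquiv (f := σ) fun x => ?_
      invFun := fun σ => σ.toRingEquiv
      left_inv := fun σ => rfl
      right_inv := fun σ => rfl }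
  exact congr_fun (congr_arg DFunLike.coe (Subsingleton.elim
    ((σ : F →+* F).comp (algebraMap (ZMod p) F)) (algebraMap (ZMod p) F))) x

/-- The minimal polynomial of a generator has degree equal to that of the field. -/
theorem aeval_ne_zero_of_natDegree_lt [Finite F] {α : F}
    (hα : Function.Surjective (aeval α : ℤ[X] →ₐ[ℤ] F)) {c : (ZMod p)[X]} (hc : c ≠ 0)
    (hdeg : c.natDegree < Module.finrank (ZMod p) F) : aeval α c ≠ 0 := by
  intro h
  rw [surjective_aeval_int_iff p, Field.primitive_element_iff_minpoly_natDegree_eq] at hα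
  have := natDegree_le_of_dvd (minpoly.dvd _ _ h) hc
  omega

/-- A non-generator lies in a proper subfield, whose degree `d` is a proper divisor of that of `F`;
the `d`-th power of Frobenius fixes it. -/
theorem exists_pow_eq_self_of_not_surjective [Finite F] {α : F}
    (hα : ¬ Function.Surjective (aeval α : ℤ[X] →ₐ[ℤ] F)) :
    ∃ d, 0 < d ∧ d ≤ Module.finrank (ZMod p) F / 2 ∧ α ^ p ^ d = α := by
  rw [surjective_aeval_int_iff p] at hα
  let K := IntermediateField.adjoin (ZMod p) {α}
  have hmul := Module.finrank_mul_finrank (ZMod p) K F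
  have hK : 0 < Module.finrank (ZMod p) K := Module.finrank_pos
  have hF : Module.finrank K F ≠ 1 := fun h =>
    hα (IntermediateField.finrank_eq_one_iff_eq_top.1 h)
  have hF0 : 0 < Module.finrank K F := Module.finrank_pos
  refine ⟨Module.finrank (ZMod p) K, hK, ?_, ?_⟩
  · rw [Nat.le_div_iff_mul_le two_pos, ← hmul]
    exact Nat.mul_le_mul_left _ (by omega)
  · let := Fintype.ofFinite K
    have h := FiniteField.pow_card (⟨α, IntermediateField.mem_adjoin_simple_self _ α⟩ : K)
    rw [← Nat.card_eq_fintype_card, natCard_eq_pow_finrank p] at h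
    exact congr_arg Subtype.val h

variable (F) in
theorem ncard_pow_eq_self_le (q : ℕ) (hq : 1 < q) : {α : F | α ^ q = α}.ncard ≤ q := by
  classical
  have h : {α : F | α ^ q = α} ⊆ ((X ^ q - X : F[X]).roots.toFinset : Set F) := by
    intro α hα
    simp only [Set.mem_ofPred_eq] at hα
    simp [FiniteField.X_pow_card_sub_X_ne_zero F hq, hα]
  calc {α : F | α ^ q = α}.ncard ≤ ((X ^ q - X : F[X]).roots.toFinset : Set F).ncard :=
        Set.ncard_le_ncard h (Finset.finite_toSet _)
    _ ≤ (X ^ q - X : F[X]).roots.card := by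
        rw [Set.ncard_coe_finset]; exact Multiset.toFinset_card_le _
    _ ≤ q := by
        exact (card_roots' _).trans_eq (FiniteField.X_pow_card_sub_X_natDegree_eq F hq)

/-- Non-generators number at most `∑ p ^ d` over `1 ≤ d ≤ k / 2`, hence at most `p ^ (k / 2 + 1) ≤ p
^ (k - 1) ≤ p ^ k / 2`. The middle step needs `k ≥ 3`. -/
theorem natCard_le_two_mul_ncard_surjective [Finite F] (hk : 3 ≤ Module.finrank (ZMod p) F) :
    Nat.card F ≤ 2 * {α : F | Function.Surjective (aeval α : ℤ[X] →ₐ[ℤ] F)}.ncard := by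
  have hp : 2 ≤ p := (Fact.out : p.Prime).two_le
  set k := Module.finrank (ZMod p) F with hkdef
  have hsub : {α : F | Function.Surjective (aeval α : ℤ[X] →ₐ[ℤ] F)}ᶜ ⊆
      ⋃ d ∈ Finset.Icc 1 (k / 2), {α : F | α ^ p ^ d = α} := by
    intro α hα
    obtain ⟨d, h1, h2, h3⟩ := exists_pow_eq_self_of_not_surjective p hα
    simp only [Set.mem_iUnion]
    exact ⟨d, Finset.mem_Icc.2 ⟨h1, h2⟩, h3⟩
  have h1 : ({α : F | Function.Surjective (aeval α : ℤ[X] →ₐ[ℤ] F)}ᶜ).ncard ≤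
      ∑ d ∈ Finset.Icc 1 (k / 2), p ^ d := by
    refine (Set.ncard_le_ncard hsub (Set.toFinite _)).trans ?_
    refine (Finset.set_ncard_biUnion_le _ _).trans ?_
    refine Finset.sum_le_sum fun d hd => ncard_pow_eq_self_le F _ ?_
    exact Nat.one_lt_pow (by have := (Finset.mem_Icc.1 hd).1; omega) (by omega)
  have h2 : ∑ d ∈ Finset.Icc 1 (k / 2), p ^ d ≤ p ^ (k / 2 + 1) := by
    refine le_trans (Finset.sum_le_sum_of_subset (t := Finset.range (k / 2 + 1)) ?_)
      (Nat.geomSum_lt hp (by simp)).le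
    intro d hd
    have := (Finset.mem_Icc.1 hd).2
    simp; omega
  have h3 : p ^ (k / 2 + 1) ≤ p ^ (k - 1) := Nat.pow_le_pow_right (by omega) (by omega)
  have h4 : 2 * p ^ (k - 1) ≤ p ^ k := by
    obtain ⟨j, hj⟩ : ∃ j, k = j + 1 := ⟨k - 1, by omega⟩
    rw [hj, Nat.add_sub_cancel, pow_succ, mul_comm]
    exact Nat.mul_le_mul_left _ hp
  have h5 := Set.ncard_add_ncard_compl {α : F | Function.Surjective (aeval α : ℤ[X] →ₐ[ℤ] F)}
  have h6 := natCard_eq_pow_finrank p (F := F)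
  rw [← hkdef] at h6
  omega

end FiniteField

/-! ### The counting formula for maximal submodules of `N`. -/

section Counting

universe u

/-- The number of additive maps `N → F` on which `x` acts as `α`. -/
noncomputable def homCard (N : Type u) [AddCommGroup N] [Module ℤ[X] N] {F : Type*} [Field F]
    (α : F) : ℕ :=
  Nat.card (N →ₛₗ[((aeval α : ℤ[X] →ₐ[ℤ] F) : ℤ[X] →+* F)] F)

/-- The elements generating a finite field as a ring. -/
noncomputable def ringGenerators (F : Type*) [Field F] [Finite F] : Finset F :=
  (Set.toFinite {α : F | Function.Surjective (aeval α : ℤ[X] →ₐ[ℤ] F)}).toFinset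

theorem mem_ringGenerators {F : Type*} [Field F] [Finite F] {α : F} :
    α ∈ ringGenerators F ↔ Function.Surjective (aeval α : ℤ[X] →ₐ[ℤ] F) := by
  simp [ringGenerators]

theorem natCard_le_two_mul_card_ringGenerators (p : ℕ) [Fact p.Prime] (F : Type*) [Field F]
    [Algebra (ZMod p) F] [Finite F] (hk : 3 ≤ Module.finrank (ZMod p) F) :
    Nat.card F ≤ 2 * (ringGenerators F).card := by
  rw [ringGenerators, ← Set.ncard_eq_toFinset_card]
  exact natCard_le_two_mul_ncard_surjective p hk

variable (N : Type u) [AddCommGroup N] [Module ℤ[X] N]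

/-- The ring generators of `F` are the surjective ring homomorphisms `ℤ[X] → F`. -/
noncomputable def ringGeneratorsEquiv (F : Type*) [Field F] [Finite F] :
    ringGenerators F ≃ {ε : ℤ[X] →+* F // Function.Surjective ε} where
  toFun α := ⟨(aeval α.1 : ℤ[X] →ₐ[ℤ] F), mem_ringGenerators.1 α.2⟩
  invFun ε := ⟨ε.1 X, mem_ringGenerators.2 (by
    have : ((aeval (ε.1 X) : ℤ[X] →ₐ[ℤ] F) : ℤ[X] →+* F) = ε.1 :=
      Polynomial.ringHom_ext' (RingHom.ext_int _ _) (by simp)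
    have h2 : ⇑(aeval (ε.1 X) : ℤ[X] →ₐ[ℤ] F) = ⇑ε.1 := congr_arg DFunLike.coe this
    rw [h2]
    exact ε.2)⟩
  left_inv α := Subtype.ext (by simp)
  right_inv ε := Subtype.ext (Polynomial.ringHom_ext' (RingHom.ext_int _ _) (by simp))

variable [Module.Finite ℤ[X] N]

theorem natCard_simpleQuotientMaps (F : Type*) [Field F] [Finite F] :
    Nat.card (SimpleQuotientMaps ℤ[X] F N) = ∑ α ∈ ringGenerators F, (homCard N α - 1) := by
  have := Finite.of_equiv _ (ringGeneratorsEquiv F)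
  let := Fintype.ofFinite {ε : ℤ[X] →+* F // Function.Surjective ε}
  have hfin : ∀ ε : {ε : ℤ[X] →+* F // Function.Surjective ε}, Finite (N →ₛₗ[ε.1] F) :=
    fun ε => finite_semilinearMap _
  rw [Nat.card_sigma, ← Finset.sum_coe_sort (ringGenerators F), ← (ringGeneratorsEquiv F).sum_comp]
  refine Finset.sum_congr rfl fun α _ => ?_
  have := hfin (ringGeneratorsEquiv F α)
  let := Fintype.ofFinite (N →ₛₗ[(ringGeneratorsEquiv F α).1] F)
  classical
  change _ = Nat.card (N →ₛₗ[(ringGeneratorsEquiv F α).1] F) - 1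
  rw [Nat.card_eq_fintype_card, Nat.card_eq_fintype_card, Fintype.card_subtype_compl,
    Fintype.card_subtype_eq]

theorem finite_maxSubmodules (n : ℕ) (hn : 0 < n) : (maxSubmodules ℤ[X] N n).Finite := by
  by_cases h : IsPrimePow n
  · obtain ⟨p, k, hp, hk, rfl⟩ := h
    have : Fact p.Prime := ⟨hp.nat_prime⟩
    have hcard := GaloisField.card p k hk.ne'
    have := Finite.of_equiv _ (ringGeneratorsEquiv (GaloisField p k))
    have hfin : ∀ ε : {ε : ℤ[X] →+* GaloisField p k // Function.Surjective ε},
      Finite (N →ₛₗ[ε.1] GaloisField p k) := fun ε => finite_semilinearMap _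
    have hT : Finite (SimpleQuotientMaps ℤ[X] (GaloisField p k) N) := inferInstance
    rw [← hcard]
    refine (Set.finite_range fun t : SimpleQuotientMaps ℤ[X] (GaloisField p k) N =>
      LinearMap.ker t.2.1).subset fun M hM => ?_
    obtain ⟨ε, φ, h1, h2, h3⟩ := exists_ker_eq_of_mem_maxSubmodules hM
    exact ⟨⟨⟨ε, h1⟩, ⟨φ, h2⟩⟩, h3⟩
  · convert Set.finite_empty
    exact Set.eq_empty_of_forall_notMem fun M hM => h (isPrimePow_of_mem_maxSubmodules hn hM)

variable {N} in
omit [Module.Finite ℤ[X] N] in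
theorem maxSubmoduleCount_eq_zero {n : ℕ} (hn : 0 < n) (h : ¬ IsPrimePow n) :
    maxSubmoduleCount ℤ[X] N n = 0 := by
  rw [maxSubmoduleCount, Set.eq_empty_of_forall_notMem fun M hM =>
    h (isPrimePow_of_mem_maxSubmodules hn hM), Set.ncard_empty]

/-- The count of maximal submodules of index `q` in terms of maps to the field with `q` elements. -/
theorem maxSubmoduleCount_mul_eq (p : ℕ) [Fact p.Prime] (F : Type*) [Field F]
    [Algebra (ZMod p) F] [Finite F] :
    maxSubmoduleCount ℤ[X] N (Nat.card F) * ((Nat.card F - 1) * Module.finrank (ZMod p) F) =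
      ∑ α ∈ ringGenerators F, (homCard N α - 1) := by
  rw [← natCard_simpleQuotientMaps, ← card_maxSubmodules_mul_eq, natCard_ringAut p,
    Nat.card_units]
  rfl

end Counting

/-! ### The number of maps at a point `α`, for fixed `p` and for almost all `p`. -/

section Specializations

universe u

variable (N : Type u) [AddCommGroup N] [Module ℤ[X] N] [Module.Finite ℤ[X] N]

/-- `N/pN` agrees with a free module of rank `r(p)` up to some `c ≠ 0`, and a generator of a field
of degree above `deg c` is not a root of `c`. -/
theorem exists_homCard_eq_pow_rankModP (p : ℕ) (hp : p.Prime) [Fact p.Prime] :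
    ∃ K : ℕ, ∀ (F : Type) [Field F] [Algebra (ZMod p) F] [Finite F],
      K ≤ Module.finrank (ZMod p) F → ∀ α ∈ ringGenerators F,
        homCard N α = Nat.card F ^ rankModP N ⟨p, hp⟩ := by
  obtain ⟨v, c, hc, hker, hrange⟩ :=
    exists_injective_finFun_of_isDomain (R := (ZMod p)[X]) (N := ModPModule N p)
  refine ⟨c.natDegree + 1, fun F _ _ _ hF α hα => ?_⟩
  have hchar : CharP F p := charP_of_injective_algebraMap (algebraMap (ZMod p) F).injective p
  have hε := aeval_ne_zero_of_natDegree_lt p (mem_ringGenerators.1 hα) hc (by omega)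
  have h1 := card_semilinearMap_eq_of_smul (F := F) ((aeval α : (ZMod p)[X] →ₐ[ZMod p] F) :
    (ZMod p)[X] →+* F) v c hε hker hrange
  rw [card_semilinearMap_finFun] at h1
  rw [homCard]
  have h2 : ((aeval α : ℤ[X] →ₐ[ℤ] F) : ℤ[X] →+* F) =
      ((aeval α : (ZMod p)[X] →ₐ[ZMod p] F) : (ZMod p)[X] →+* F).comp
        (mapRingHom (Int.castRingHom (ZMod p))) :=
    RingHom.ext fun f => aeval_int_eq p α f
  rw [h2, card_semilinearMap_modPModule, h1]
  rfl

variable {N} in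
/-- Over almost all primes, the module looks like its rational decomposition. -/
theorem HasInvariantFactorForm.exists_homCard_eq {s r : ℕ} (h : HasInvariantFactorForm N s r) :
    ∃ (b : Fin s → ℤ[X]) (m : ℤ), m ≠ 0 ∧ (∀ j, 0 < (b j).natDegree) ∧
      (∀ j, (b j).leadingCoeff ∣ m) ∧
      ∀ (F : Type) [Field F] [Finite F], (m : F) ≠ 0 → ∀ α : F,
        (∀ i j, i ≤ j → aeval α (b i) = 0 → aeval α (b j) = 0) ∧
        homCard N α = Nat.card F ^ (r + {j | aeval α (b j) = 0}.ncard) := by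
  classical
  obtain ⟨a, ha, hdvd, ⟨e⟩⟩ := h
  choose c b hc hb using fun j => exists_intPolynomial_map_eq (a j)
  have hb0 : ∀ j, b j ≠ 0 := by
    intro j h0
    have := hb j
    rw [h0, Polynomial.map_zero, eq_comm, mul_eq_zero, or_iff_left (ha j).1] at this
    exact (isUnit_intCast_ratPolynomial (hc j)).ne_zero this
  have hdeg : ∀ j, 0 < (b j).natDegree := by
    intro j
    have h1 := natDegree_map_eq_of_injective (f := Int.castRingHom ℚ) Int.cast_injective (b j)
    rw [hb, natDegree_mul (isUnit_intCast_ratPolynomial (hc j)).ne_zero (ha j).1,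
      natDegree_intCast, zero_add] at h1
    rw [← h1, Nat.pos_iff_ne_zero]
    intro h0
    refine (ha j).2 ?_
    rw [eq_C_of_natDegree_eq_zero h0, isUnit_C, isUnit_iff_ne_zero]
    intro h2
    exact (ha j).1 (by rw [eq_C_of_natDegree_eq_zero h0, h2, C_0])
  have hdvd' : ∀ i j, i ≤ j → ∃ k : ℤ, k ≠ 0 ∧ b i ∣ (k : ℤ[X]) * b j := by
    intro i j hij
    refine exists_dvd_intCast_mul ?_
    rw [hb, hb, (isUnit_intCast_ratPolynomial (hc i)).mul_left_dvd]
    exact (hdvd i j hij).mul_left _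
  have hdvd'' : ∀ w : Fin s × Fin s, ∃ k : ℤ, k ≠ 0 ∧ (w.1 ≤ w.2 → b w.1 ∣ (k : ℤ[X]) * b w.2) := by
    intro w
    by_cases hw : w.1 ≤ w.2
    · obtain ⟨k, hk, h⟩ := hdvd' w.1 w.2 hw
      exact ⟨k, hk, fun _ => h⟩
    · exact ⟨1, one_ne_zero, fun h => absurd h hw⟩
  choose k hk0 hk using hdvd''
  have hbot : Ideal.span {(0 : ℚ[X])} = ⊥ := by simp
  let e' : RatModule N ≃ₗ[ℚ[X]] Π i : Fin s ⊕ Fin r,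
      ℚ[X] ⧸ Ideal.span {(Sum.elim a 0 : Fin s ⊕ Fin r → ℚ[X]) i} :=
    e.trans <| (LinearEquiv.prodCongr (LinearEquiv.refl _ _)
      (LinearEquiv.piCongrRight fun _ => (Submodule.quotEquivOfEqBot _ hbot).symm)).trans
      (LinearEquiv.sumPiEquivProdPi ℚ[X] (Fin s) (Fin r) fun i =>
        ℚ[X] ⧸ Ideal.span {(Sum.elim a 0 : Fin s ⊕ Fin r → ℚ[X]) i}).symm
  obtain ⟨v, m, hm, hker, hrange⟩ := exists_spreading_out (b := Sum.elim b 0) e' (Sum.elim c 1)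
    (by rintro (j | j); exacts [hc j, one_ne_zero]) (by rintro (j | j); exacts [hb j, by simp])
  -- The excluded primes divide the spreading-out integer, a leading coefficient, or a constant
  -- spoiling a divisibility `b i ∣ b j` over `ℤ`.
  refine ⟨b, m * ((∏ j, (b j).leadingCoeff) * ∏ w, k w), ?_, hdeg, ?_, ?_⟩
  · exact mul_ne_zero hm (mul_ne_zero (Finset.prod_ne_zero_iff.2 fun j _ =>
      leadingCoeff_ne_zero.2 (hb0 j)) (Finset.prod_ne_zero_iff.2 fun w _ => hk0 w))
  · intro j
    exact ((Finset.dvd_prod_of_mem (fun j => (b j).leadingCoeff)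
      (Finset.mem_univ j)).mul_right _).mul_left _
  · intro F _ _ hF α
    simp only [Int.cast_mul, ne_eq, mul_eq_zero, not_or] at hF
    constructor
    · intro i j hij h0
      obtain ⟨t, ht⟩ := hk (i, j) hij
      have h1 := congr_arg (aeval α) ht
      rw [map_mul, map_mul, h0, zero_mul, map_intCast, mul_eq_zero] at h1
      refine h1.resolve_left fun h2 => hF.2.2 ?_
      obtain ⟨l, hl⟩ := Finset.dvd_prod_of_mem k (Finset.mem_univ (i, j))
      rw [hl, Int.cast_mul, h2, zero_mul]
    · have h1 := card_semilinearMap_eq_of_smul ((aeval α : ℤ[X] →ₐ[ℤ] F) : ℤ[X] →+* F) v m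
        (by rw [map_intCast]; exact hF.1) hker hrange
      rw [homCard, h1, card_semilinearMap_pi_quotient]
      congr 1
      rw [Finset.card_filter, Fintype.sum_sum_type, ← Finset.card_filter, ← Finset.card_filter,
        add_comm]
      congr 1
      · simp
      · rw [← Set.ncard_coe_finset]
        congr 1
        ext j
        rw [Finset.mem_coe, Finset.mem_filter_univ]
        exact Iff.rfl

end Specializations

/-! ### Vanishing of all ranks and of `ℚN` forces `N` to be finite. -/

section Finiteness

universe u

theorem finite_of_smul_eq_zero {R V : Type*} [CommRing R] [AddCommGroup V] [Module R V]
    [Module.Finite R V] (I : Ideal R) [Finite (R ⧸ I)] (h : ∀ f ∈ I, ∀ v : V, f • v = 0) :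
    Finite V := by
  obtain ⟨s, hs⟩ := Module.Finite.fg_top (R := R) (M := V)
  refine Finite.of_surjective (fun w : s → R ⧸ I => ∑ i, (w i).out • (i : V)) fun v => ?_
  have hv : v ∈ Submodule.span R (s : Set V) := hs ▸ trivial
  obtain ⟨f, -, rfl⟩ := Submodule.mem_span_finset.1 hv
  refine ⟨fun i => Ideal.Quotient.mk I (f i), ?_⟩
  rw [← Finset.sum_coe_sort s]
  refine Finset.sum_congr rfl fun i _ => ?_
  rw [← sub_eq_zero, ← sub_smul]
  exact h _ (Ideal.Quotient.eq.1 (Ideal.Quotient.mk_out _)) _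

variable (N : Type u) [AddCommGroup N] [Module ℤ[X] N] [Module.Finite ℤ[X] N]

theorem finite_modPModule_of_rankModP_eq_zero (p : Nat.Primes) (h : rankModP N p = 0) :
    Finite (ModPModule N p) := by
  have : Fact (p : ℕ).Prime := ⟨p.2⟩
  obtain ⟨v, c, hc, -, hrange⟩ :=
    exists_injective_finFun_of_isDomain (R := (ZMod p)[X]) (N := ModPModule N p)
  have hsub : ∀ y, v y = 0 := fun y => by
    have : y = 0 := funext fun i => (Fin.cast h i).elim0
    rw [this, map_zero]
  have := (AdjoinRoot.powerBasis hc).finite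
  have : Finite (AdjoinRoot c) := Module.finite_of_finite (ZMod p)
  have : Finite ((ZMod p)[X] ⧸ Ideal.span {c}) := this
  refine finite_of_smul_eq_zero (Ideal.span {c}) fun f hf z => ?_
  obtain ⟨g, rfl⟩ := Ideal.mem_span_singleton.1 hf
  obtain ⟨y, hy⟩ := hrange (g • z)
  rw [mul_smul, ← hy, hsub]

/-- Representatives modulo `p * a` are `t + p • t'`, with `t` representing `N/pN` and `t'`
representing `N/aN`. -/
theorem exists_finite_representatives (h : ∀ p, rankModP N p = 0) (m : ℕ) :
    m ≠ 0 → ∃ T : Set N, T.Finite ∧ ∀ n, ∃ t ∈ T, ∃ n', n = t + (m : ℤ[X]) • n' := by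
  induction m using induction_on_primes with
  | zero => exact fun h => absurd rfl h
  | one => exact fun _ => ⟨{0}, Set.finite_singleton 0, fun n => ⟨0, rfl, n, by simp⟩⟩
  | prime_mul p a hp ih =>
    intro hpa
    obtain ⟨T, hT, hTn⟩ := ih (right_ne_zero_of_mul hpa)
    have := finite_modPModule_of_rankModP_eq_zero N ⟨p, hp⟩ (h _)
    choose g hg using toModPModule_surjective N p
    have hfin : (Set.range g).Finite := Set.finite_range g
    refine ⟨Set.image2 (fun t t' => t + (p : ℤ[X]) • t') (Set.range g) T, hfin.image2 _ hT,
      fun n => ?_⟩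
    have h1 : toModPModule N p (n - g (toModPModule N p n)) = 0 := by
      rw [map_sub, hg, sub_self]
    obtain ⟨n', hn'⟩ := exists_eq_smul_of_toModPModule N p h1
    obtain ⟨t, ht, n'', rfl⟩ := hTn n'
    refine ⟨_, ⟨_, ⟨toModPModule N p n, rfl⟩, t, ht, rfl⟩, n'', ?_⟩
    refine (eq_add_of_sub_eq' hn').trans ?_
    push_cast
    rw [smul_add, mul_smul, add_assoc]

/-- As `ℚN = 0`, a nonzero integer `m` kills `N`, so `N = N/mN`, which is finite. -/
theorem finite_of_hasInvariantFactorForm_zero (h : HasInvariantFactorForm N 0 0)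
    (hr : ∀ p, rankModP N p = 0) : Finite N := by
  obtain ⟨a, -, -, ⟨e⟩⟩ := h
  have h0 : ∀ z : RatModule N, z = 0 := fun z => e.injective (Subsingleton.elim _ _)
  obtain ⟨s, ⟨m, hm, rfl⟩, hs⟩ := (Module.Finite.fg_top (R := ℤ[X]) (M := N)).exists_smul_mem ⊥
    ((nonZeroDivisors ℤ).map (Int.castRingHom ℤ[X])) fun n _ => by
      obtain ⟨m, hm, hmn⟩ := exists_smul_eq_zero_of_toRatModule N (h0 (toRatModule N n))
      exact ⟨_, ⟨m, mem_nonZeroDivisors_of_ne_zero hm, rfl⟩, hmn⟩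
  obtain ⟨T, hT, hTn⟩ := exists_finite_representatives N hr m.natAbs
    (Int.natAbs_ne_zero.2 (nonZeroDivisors.ne_zero hm))
  refine Set.finite_univ_iff.1 (hT.subset fun n _ => ?_)
  obtain ⟨t, ht, n', rfl⟩ := hTn n
  have h1 : (m : ℤ[X]) • n' = 0 := hs n' trivial
  have h2 : (m.natAbs : ℤ[X]) • n' = 0 := by
    rcases Int.natAbs_eq m with h | h
    · rw [h] at h1; simpa using h1
    · rw [h] at h1; simpa using h1
  rwa [h2, add_zero]

end Finiteness

/-! ### Uniform bounds over large primes, and the ranks `r(p)`. -/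

section GenericPrimes

universe u

variable {N : Type u} [AddCommGroup N] [Module ℤ[X] N] [Module.Finite ℤ[X] N]

theorem ncard_aeval_eq_zero_le {F : Type*} [Field F] {b : ℤ[X]} (hb : (b.leadingCoeff : F) ≠ 0) :
    {α : F | aeval α b = 0}.ncard ≤ b.natDegree := by
  classical
  have h0 : b.map (Int.castRingHom F) ≠ 0 := fun h => hb (by
    have := congr_arg (fun f => coeff f b.natDegree) h
    simpa using this)
  have h : {α : F | aeval α b = 0} ⊆ ((b.map (Int.castRingHom F)).roots.toFinset : Set F) := by
    intro α hα
    have : eval₂ (Int.castRingHom F) α b = 0 := hα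
    simp [h0, eval_map, this]
  calc {α : F | aeval α b = 0}.ncard
      ≤ ((b.map (Int.castRingHom F)).roots.toFinset : Set F).ncard :=
        Set.ncard_le_ncard h (Finset.finite_toSet _)
    _ ≤ (b.map (Int.castRingHom F)).roots.card := by
        rw [Set.ncard_coe_finset]; exact Multiset.toFinset_card_le _
    _ ≤ b.natDegree := (card_roots' _).trans natDegree_map_le

/-- An integer polynomial has a root generating a finite field of small degree. -/
theorem exists_ringGenerator_aeval_eq_zero (p : ℕ) [Fact p.Prime] {b : ℤ[X]}
    (hdeg : 0 < b.natDegree) (hb : ((b.leadingCoeff : ℤ) : ZMod p) ≠ 0) :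
    ∃ (F : Type) (_ : Field F) (_ : Algebra (ZMod p) F) (_ : Finite F), ∃ α ∈ ringGenerators F,
      aeval α b = 0 ∧ Module.finrank (ZMod p) F ≤ b.natDegree := by
  have hd : (b.map (Int.castRingHom (ZMod p))).natDegree = b.natDegree :=
    natDegree_map_of_leadingCoeff_ne_zero _ hb
  have h0 : b.map (Int.castRingHom (ZMod p)) ≠ 0 := fun h => by rw [h] at hd; simp at hd; omega
  have hu : ¬ IsUnit (b.map (Int.castRingHom (ZMod p))) := fun h => by
    have := natDegree_eq_zero_of_isUnit h
    omega
  -- Adjoining a root of an irreducible factor of `b` modulo `p` gives the field.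
  obtain ⟨g, hg, hgb⟩ := WfDvdMonoid.exists_irreducible_factor hu h0
  have : Fact (Irreducible g) := ⟨hg⟩
  have hfin := (AdjoinRoot.powerBasis hg.ne_zero).finite
  have hfinite : Finite (AdjoinRoot g) := Module.finite_of_finite (ZMod p)
  refine ⟨AdjoinRoot g, inferInstance, inferInstance, hfinite, AdjoinRoot.root g, ?_, ?_, ?_⟩
  · rw [mem_ringGenerators]
    intro y
    obtain ⟨f, rfl⟩ := AdjoinRoot.mk_surjective y
    obtain ⟨f, rfl⟩ := map_surjective (Int.castRingHom (ZMod p)) ZMod.intCast_surjective f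
    exact ⟨f, by rw [aeval_int_eq p, AdjoinRoot.aeval_eq]⟩
  · rw [aeval_int_eq p, AdjoinRoot.aeval_eq, AdjoinRoot.mk_eq_zero]
    exact hgb
  · rw [(AdjoinRoot.powerBasis hg.ne_zero).finrank, AdjoinRoot.powerBasis_dim, ← hd]
    exact natDegree_le_of_dvd hgb h0

theorem HasInvariantFactorForm.exists_generic {s r : ℕ} (h : HasInvariantFactorForm N s r) :
    ∃ M B : ℕ, ∀ (p : ℕ) [Fact p.Prime], M < p →
      (∀ (F : Type) [Field F] [Algebra (ZMod p) F] [Finite F],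
        (∀ α : F, homCard N α ≤ Nat.card F ^ (s + r)) ∧
        (∀ α : F, s = 0 → homCard N α = Nat.card F ^ r) ∧
        {α : F | homCard N α ≠ Nat.card F ^ r}.ncard ≤ B) ∧
      (0 < s → ∃ (F : Type) (_ : Field F) (_ : Algebra (ZMod p) F) (_ : Finite F),
        ∃ α ∈ ringGenerators F, homCard N α = Nat.card F ^ (s + r) ∧
          Module.finrank (ZMod p) F ≤ B) := by
  obtain ⟨b, m, hm, hdeg, hlead, hF⟩ := h.exists_homCard_eq
  -- A prime above `|m|` does not divide `m`. The sum of degrees bounds both the number of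
  -- exceptional `α` and the residue degree of a root of the first factor.
  refine ⟨m.natAbs, ∑ j, (b j).natDegree, fun p _ hp => ?_⟩
  have hmp : ∀ (F : Type) [Field F] [Algebra (ZMod p) F], (m : F) ≠ 0 := by
    intro F _ _ h0
    have hchar : CharP F p := charP_of_injective_algebraMap (algebraMap (ZMod p) F).injective p
    have h1 := Int.le_of_dvd (Int.natAbs_pos.2 hm |> Int.natCast_pos.2)
      (Int.dvd_natAbs.2 ((CharP.intCast_eq_zero_iff F p m).1 h0))
    omega
  have hlp : ∀ (F : Type) [Field F] [Algebra (ZMod p) F] (j : Fin s),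
      ((b j).leadingCoeff : F) ≠ 0 := by
    intro F _ _ j h0
    obtain ⟨t, ht⟩ := hlead j
    exact hmp F (by rw [ht, Int.cast_mul, h0, zero_mul])
  refine ⟨fun F _ _ _ => ⟨fun α => ?_, fun α hs => ?_, ?_⟩, fun hs => ?_⟩
  · rw [(hF F (hmp F) α).2, add_comm s r]
    refine Nat.pow_le_pow_right Nat.card_pos (Nat.add_le_add_left ?_ _)
    have := Set.ncard_le_card {j | aeval α (b j) = 0}
    simpa using this
  · subst hs
    rw [(hF F (hmp F) α).2, Set.eq_empty_of_isEmpty {j | aeval α (b j) = 0}, Set.ncard_empty,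
      add_zero]
  · have hsub : {α : F | homCard N α ≠ Nat.card F ^ r} ⊆
        ⋃ j ∈ (Finset.univ : Finset (Fin s)), {α : F | aeval α (b j) = 0} := by
      intro α hα
      by_contra hne
      refine hα ?_
      rw [(hF F (hmp F) α).2]
      have : {j | aeval α (b j) = 0} = ∅ := by
        refine Set.eq_empty_of_forall_notMem fun j hj => hne ?_
        simp only [Set.mem_iUnion]
        exact ⟨j, Finset.mem_univ j, hj⟩
      rw [this, Set.ncard_empty, add_zero]
    refine (Set.ncard_le_ncard hsub (Set.toFinite _)).trans ?_
    refine (Finset.set_ncard_biUnion_le _ _).trans ?_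
    exact Finset.sum_le_sum fun j _ => ncard_aeval_eq_zero_le (hlp F j)
  · obtain ⟨F, i1, i2, i3, α, hα, h0, hk⟩ :=
      exists_ringGenerator_aeval_eq_zero p (hdeg ⟨0, hs⟩) (hlp (ZMod p) _)
    refine ⟨F, i1, i2, i3, α, hα, ?_, hk.trans ?_⟩
    · obtain ⟨h1, h2⟩ := hF F (hmp F) α
      -- A root of the first factor is a root of all, by the divisibility chain.
      have : {j | aeval α (b j) = 0} = Set.univ :=
        Set.eq_univ_of_forall fun j => h1 _ j (Fin.mk_le_of_le_val (Nat.zero_le _)) h0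
      rw [h2, this, Set.ncard_univ, Nat.card_eq_fintype_card (α := Fin s), Fintype.card_fin,
        add_comm]
    · exact Finset.single_le_sum (f := fun j => (b j).natDegree) (fun _ _ => Nat.zero_le _)
        (Finset.mem_univ _)

theorem exists_uniform_homCard_eq_pow_rankModP (N : Type u) [AddCommGroup N] [Module ℤ[X] N]
    [Module.Finite ℤ[X] N] (M : ℕ) :
    ∃ K : ℕ, ∀ (p : ℕ) (hp : p.Prime) [Fact p.Prime], p ≤ M →
      ∀ (F : Type) [Field F] [Algebra (ZMod p) F] [Finite F],
      K ≤ Module.finrank (ZMod p) F → ∀ α ∈ ringGenerators F,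
        homCard N α = Nat.card F ^ rankModP N ⟨p, hp⟩ := by
  classical
  have h : ∀ p : ℕ, ∃ K : ℕ, ∀ (hp : p.Prime) [Fact p.Prime],
      ∀ (F : Type) [Field F] [Algebra (ZMod p) F] [Finite F],
      K ≤ Module.finrank (ZMod p) F → ∀ α ∈ ringGenerators F,
        homCard N α = Nat.card F ^ rankModP N ⟨p, hp⟩ := by
    intro p
    by_cases hp : p.Prime
    · have : Fact p.Prime := ⟨hp⟩
      obtain ⟨K, hK⟩ := exists_homCard_eq_pow_rankModP N p hp
      exact ⟨K, fun _ _ => hK⟩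
    · exact ⟨0, fun hp' => absurd hp' hp⟩
  choose K hK using h
  refine ⟨∑ p ∈ Finset.range (M + 1), K p, fun p hp _ hpM F _ _ _ hF => hK p hp F (le_trans ?_ hF)⟩
  exact Finset.single_le_sum (f := K) (fun _ _ => Nat.zero_le _) (Finset.mem_range.2 (by omega))

/-- In a large extension of `𝔽_p` there are more than `B` generators, so some generator is not
exceptional. There both formulas for `homCard` hold, and their exponents agree. -/
theorem HasInvariantFactorForm.exists_rankModP_eq {s r : ℕ} (h : HasInvariantFactorForm N s r) :
    ∃ M : ℕ, ∀ p : Nat.Primes, M < p → rankModP N p = r := by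
  obtain ⟨M, B, hMB⟩ := h.exists_generic
  refine ⟨M, fun p hp => ?_⟩
  have : Fact (p : ℕ).Prime := ⟨p.2⟩
  obtain ⟨K, hK⟩ := exists_homCard_eq_pow_rankModP N p p.2
  have hk0 : K + B + 3 ≠ 0 := by omega
  let F := GaloisField p (K + B + 3)
  have hfr : Module.finrank (ZMod p) F = K + B + 3 := GaloisField.finrank _ hk0
  obtain ⟨-, -, hB⟩ := (hMB p hp).1 F
  have hq := natCard_le_two_mul_card_ringGenerators p F (by omega)
  have hcard : 2 * B < Nat.card F := by
    rw [natCard_eq_pow_finrank p, hfr]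
    calc 2 * B < 2 * 2 ^ B := by have := Nat.lt_two_pow_self (n := B); omega
      _ = 2 ^ (B + 1) := by rw [pow_succ, mul_comm]
      _ ≤ (p : ℕ) ^ (B + 1) := Nat.pow_le_pow_left p.2.two_le _
      _ ≤ (p : ℕ) ^ (K + B + 3) := Nat.pow_le_pow_right p.2.pos (by omega)
  obtain ⟨α, hα, hr⟩ : ∃ α ∈ ringGenerators F, homCard N α = Nat.card F ^ r := by
    by_contra! hne
    have h1 : (ringGenerators F : Set F).ncard ≤ {α : F | homCard N α ≠ Nat.card F ^ r}.ncard :=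
      Set.ncard_le_ncard (fun α hα => hne α hα) (Set.toFinite _)
    rw [Set.ncard_coe_finset] at h1
    omega
  rw [hK F (by omega) α hα] at hr
  exact Nat.pow_right_injective (Finite.one_lt_card (α := F)) hr

theorem isGreatest_rankMax (N : Type u) [AddCommGroup N] [Module ℤ[X] N] [Module.Finite ℤ[X] N] :
    IsGreatest (Set.range (rankModP N)) (rankMax N) := by
  obtain ⟨s, r, h⟩ := exists_hasInvariantFactorForm N
  obtain ⟨M, hM⟩ := h.exists_rankModP_eq
  have hfin : (Set.range (rankModP N)).Finite := by
    have h1 : {p : Nat.Primes | (p : ℕ) ≤ M}.Finite :=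
      Set.Finite.of_finite_image ((Set.finite_Iic M).subset (by rintro _ ⟨p, hp, rfl⟩; exact hp))
        Subtype.val_injective.injOn
    refine ((h1.image (rankModP N)).union (Set.finite_singleton r)).subset ?_
    rintro _ ⟨p, rfl⟩
    by_cases hp : (p : ℕ) ≤ M
    · exact Or.inl ⟨p, hp, rfl⟩
    · exact Or.inr (hM p (by omega))
  have hne : (Set.range (rankModP N)).Nonempty := ⟨_, ⟨⟨2, Nat.prime_two⟩, rfl⟩⟩
  exact ⟨Nat.sSup_mem hne hfin.bddAbove, fun _ hx => le_csSup hfin.bddAbove hx⟩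

theorem HasInvariantFactorForm.le_rankMax {s r : ℕ} (h : HasInvariantFactorForm N s r) :
    r ≤ rankMax N := by
  obtain ⟨M, hM⟩ := h.exists_rankModP_eq
  obtain ⟨p, hp, hpp⟩ := Nat.exists_infinite_primes (M + 1)
  exact (isGreatest_rankMax N).2 ⟨⟨p, hpp⟩, hM ⟨p, hpp⟩ hp⟩

end GenericPrimes

/-! ### Upper and lower bounds for the growth. -/

section Growth

universe u

variable {N : Type u} [AddCommGroup N] [Module ℤ[X] N] [Module.Finite ℤ[X] N]

theorem HasInvariantFactorForm.exists_upper_bound {s r : ℕ} (h : HasInvariantFactorForm N s r) :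
    ∃ M B n₀ : ℕ, ∀ n, n₀ ≤ n → maxSubmoduleCount ℤ[X] N n ≠ 0 →
      ∃ p k, p.Prime ∧ 0 < k ∧ n = p ^ k ∧
        (maxSubmoduleCount ℤ[X] N n * ((n - 1) * k) ≤ n ^ (r + 1) + B * n ^ (s + r) ∨
          p ≤ M ∧ maxSubmoduleCount ℤ[X] N n * ((n - 1) * k) ≤ n ^ (rankMax N + 1)) := by
  classical
  obtain ⟨M, B, hMB⟩ := h.exists_generic
  obtain ⟨K, hK⟩ := exists_uniform_homCard_eq_pow_rankModP N M
  -- If `p ≤ M` and `p ^ k > M ^ K` then `k ≥ K`, so the fixed-prime formula applies.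
  refine ⟨M, B, M ^ K + 1, fun n hn hcount => ?_⟩
  have hpp : IsPrimePow n := by
    by_contra hpp
    exact hcount (maxSubmoduleCount_eq_zero (by omega) hpp)
  obtain ⟨p, k, hp, hk, rfl⟩ := hpp
  have hp := hp.nat_prime
  have : Fact p.Prime := ⟨hp⟩
  refine ⟨p, k, hp, hk, rfl, ?_⟩
  let F := GaloisField p k
  have hfr : Module.finrank (ZMod p) F = k := GaloisField.finrank _ hk.ne'
  have hcard : Nat.card F = p ^ k := GaloisField.card _ _ hk.ne'
  have heq := maxSubmoduleCount_mul_eq N p F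
  have hgen : (ringGenerators F).card ≤ p ^ k := by
    rw [← hcard, ← Set.ncard_coe_finset]
    exact Set.ncard_le_card _
  rw [hfr, hcard] at heq
  rw [heq]
  by_cases hpM : p ≤ M
  · refine Or.inr ⟨hpM, ?_⟩
    have hKk : K ≤ k := by
      by_contra hlt
      have h1 : p ^ k ≤ M ^ K := (Nat.pow_le_pow_left hpM k).trans
        (Nat.pow_le_pow_right (hp.pos.trans_le hpM) (by omega))
      omega
    calc ∑ α ∈ ringGenerators F, (homCard N α - 1)
        ≤ ∑ α ∈ ringGenerators F, (p ^ k) ^ rankMax N := by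
          refine Finset.sum_le_sum fun α hα => (Nat.sub_le _ _).trans ?_
          rw [hK p hp hpM F (by omega) α hα, hcard]
          exact Nat.pow_le_pow_right (pow_pos hp.pos k) ((isGreatest_rankMax N).2 ⟨_, rfl⟩)
      _ ≤ (p ^ k) ^ (rankMax N + 1) := by
          rw [Finset.sum_const, smul_eq_mul, pow_succ, mul_comm]
          exact Nat.mul_le_mul_left _ hgen
  · left
    obtain ⟨hle, -, hB⟩ := (hMB p (by omega)).1 F
    rw [hcard] at hle hB
    calc ∑ α ∈ ringGenerators F, (homCard N α - 1)
        ≤ ∑ α ∈ ringGenerators F,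
          ((p ^ k) ^ r + if homCard N α ≠ (p ^ k) ^ r then (p ^ k) ^ (s + r) else 0) := by
          refine Finset.sum_le_sum fun α _ => (Nat.sub_le _ _).trans ?_
          split_ifs with hne
          · exact (hle α).trans (Nat.le_add_left _ _)
          · rw [not_not] at hne
            omega
      _ ≤ (p ^ k) ^ (r + 1) + B * (p ^ k) ^ (s + r) := by
          rw [Finset.sum_add_distrib, Finset.sum_const, smul_eq_mul, ← Finset.sum_filter,
            Finset.sum_const, smul_eq_mul, pow_succ, mul_comm ((p ^ k) ^ r)]
          refine Nat.add_le_add (Nat.mul_le_mul_right _ hgen) (Nat.mul_le_mul_right _ ?_)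
          rw [← Set.ncard_coe_finset]
          refine le_trans (Set.ncard_le_ncard (fun α hα => ?_) (Set.toFinite _)) hB
          exact (Finset.mem_filter.1 (Finset.mem_coe.1 hα)).2

theorem mul_le_of_mul_pred_mul_le {m n k A E : ℕ} (hn : 2 ≤ n) (hE : 0 < E)
    (h : m * ((n - 1) * k) ≤ A * n ^ E) : m * k ≤ 2 * A * n ^ (E - 1) := by
  obtain ⟨e, rfl⟩ : ∃ e, E = e + 1 := ⟨E - 1, by omega⟩
  rw [Nat.add_sub_cancel]
  refine Nat.le_of_mul_le_mul_left ?_ (show 0 < n by omega)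
  calc n * (m * k) ≤ (2 * (n - 1)) * (m * k) := Nat.mul_le_mul_right _ (by omega)
    _ = 2 * (m * ((n - 1) * k)) := by ring
    _ ≤ 2 * (A * n ^ (e + 1)) := Nat.mul_le_mul_left _ h
    _ = n * (2 * A * n ^ e) := by ring

theorem HasInvariantFactorForm.growthTypeAtMost_pow {s r E : ℕ}
    (h : HasInvariantFactorForm N s r) (hd : s + r ≤ E) (hr : rankMax N + 1 ≤ E) :
    GrowthTypeAtMost (fun n => (maxSubmoduleCount ℤ[X] N n : ℝ)) (fun n => (n : ℝ) ^ (E - 1)) := by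
  obtain ⟨M, B, n₀, hup⟩ := h.exists_upper_bound
  have hrr := h.le_rankMax
  refine ⟨((2 * (1 + B) : ℕ) : ℝ), eventually_atTop.2 ⟨n₀ + 2, fun n hn => ?_⟩⟩
  beta_reduce
  rw [Nat.abs_cast]
  by_cases h0 : maxSubmoduleCount ℤ[X] N n = 0
  · rw [h0, Nat.cast_zero]
    positivity
  obtain ⟨p, k, hp, hk, hnk, hb⟩ := hup n (by omega) h0
  have hpow : ∀ e, e ≤ E → n ^ e ≤ n ^ E := fun e he => Nat.pow_le_pow_right (by omega) he
  have hb' : maxSubmoduleCount ℤ[X] N n * ((n - 1) * k) ≤ (1 + B) * n ^ E := by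
    rw [add_mul, one_mul]
    rcases hb with hb | ⟨-, hb⟩
    · exact hb.trans (Nat.add_le_add (hpow _ (by omega)) (Nat.mul_le_mul_left _ (hpow _ hd)))
    · exact hb.trans ((hpow _ hr).trans (Nat.le_add_right _ _))
  have h1 := mul_le_of_mul_pred_mul_le (by omega) (by omega) hb'
  exact_mod_cast (Nat.le_mul_of_pos_right _ hk).trans h1

theorem HasInvariantFactorForm.growthTypeAtMost_div_log {s r : ℕ}
    (h : HasInvariantFactorForm N s r) (hd : s + r ≤ rankMax N) (hr : r < rankMax N) :
    GrowthTypeAtMost (fun n => (maxSubmoduleCount ℤ[X] N n : ℝ))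
      (fun n => (n : ℝ) ^ rankMax N / Real.log n) := by
  obtain ⟨M, B, n₀, hup⟩ := h.exists_upper_bound
  -- The first summand serves the large primes, where the bound `n ^ (r_max - 1)` and `log n ≤ n`
  -- suffice. The second serves `p ≤ M`, where `log n = k * log p ≤ k * log (M + 1)`.
  refine ⟨2 * (1 + B) + 2 * Real.log (M + 1), eventually_atTop.2 ⟨n₀ + 2, fun n hn => ?_⟩⟩
  beta_reduce
  rw [Nat.abs_cast]
  have hn1 : (1 : ℝ) < n := by exact_mod_cast (by omega : 1 < n)
  have hlog : 0 < Real.log n := Real.log_pos hn1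
  have hlogM : 0 ≤ Real.log (M + 1) := Real.log_nonneg (by simp)
  rw [mul_div_assoc', le_div_iff₀ hlog]
  by_cases h0 : maxSubmoduleCount ℤ[X] N n = 0
  · rw [h0, Nat.cast_zero, zero_mul]
    positivity
  obtain ⟨p, k, hp, hk, hnk, hb⟩ := hup n (by omega) h0
  have hpow : ∀ e, e ≤ rankMax N → n ^ e ≤ n ^ rankMax N :=
    fun e he => Nat.pow_le_pow_right (by omega) he
  rw [add_mul]
  rcases hb with hb | ⟨hpM, hb⟩
  · have hb' : maxSubmoduleCount ℤ[X] N n * ((n - 1) * k) ≤ (1 + B) * n ^ rankMax N := by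
      rw [add_mul, one_mul]
      exact hb.trans (Nat.add_le_add (hpow _ (by omega)) (Nat.mul_le_mul_left _ (hpow _ hd)))
    have h1 := mul_le_of_mul_pred_mul_le (by omega) (by omega) hb'
    have h2 : (maxSubmoduleCount ℤ[X] N n : ℝ) ≤ 2 * (1 + B) * (n : ℝ) ^ (rankMax N - 1) := by
      exact_mod_cast (Nat.le_mul_of_pos_right _ hk).trans h1
    have h3 : Real.log n ≤ n := (Real.log_le_sub_one_of_pos (by linarith)).trans (by linarith)
    calc (maxSubmoduleCount ℤ[X] N n : ℝ) * Real.log n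
        ≤ 2 * (1 + B) * (n : ℝ) ^ (rankMax N - 1) * n := by gcongr
      _ = 2 * (1 + B) * (n : ℝ) ^ rankMax N := by
          rw [mul_assoc, ← pow_succ, Nat.sub_add_cancel (by omega)]
      _ ≤ _ := le_add_of_nonneg_right (by positivity)
  · have h1 := mul_le_of_mul_pred_mul_le (A := 1) (E := rankMax N + 1) (by omega)
      (Nat.succ_pos _) (hb.trans_eq (one_mul _).symm)
    rw [Nat.add_sub_cancel, mul_one] at h1
    have h2 : (maxSubmoduleCount ℤ[X] N n : ℝ) * k ≤ 2 * (n : ℝ) ^ rankMax N := by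
      exact_mod_cast h1
    have h3 : Real.log n = k * Real.log p := by rw [hnk, Nat.cast_pow, Real.log_pow]
    have h4 : Real.log p ≤ Real.log (M + 1) :=
      Real.log_le_log (by exact_mod_cast hp.pos) (by exact_mod_cast (by omega : p ≤ M + 1))
    calc (maxSubmoduleCount ℤ[X] N n : ℝ) * Real.log n
        = (maxSubmoduleCount ℤ[X] N n : ℝ) * k * Real.log p := by rw [h3, mul_assoc]
      _ ≤ 2 * (n : ℝ) ^ rankMax N * Real.log (M + 1) := by
          have : (0 : ℝ) ≤ Real.log p := Real.log_natCast_nonneg p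
          gcongr
      _ = 2 * Real.log (M + 1) * (n : ℝ) ^ rankMax N := by ring
      _ ≤ _ := le_add_of_nonneg_left (by positivity)

theorem pow_pred_mul_le_pow_sub_one {q e : ℕ} (hq : 0 < q) (he : 0 < e) :
    q ^ (e - 1) * (q - 1) ≤ q ^ e - 1 := by
  obtain ⟨e, rfl⟩ : ∃ i, e = i + 1 := ⟨e - 1, by omega⟩
  rw [Nat.add_sub_cancel, pow_succ, Nat.mul_sub_one]
  exact Nat.sub_le_sub_left (Nat.one_le_pow _ _ hq) _

/-- A single root common to all factors contributes `q ^ (s + r) - 1`, and its residue degree stays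
bounded as `p` grows. -/
theorem HasInvariantFactorForm.growthTypeAtLeast_pow {s r : ℕ}
    (h : HasInvariantFactorForm N s r) (hs : 0 < s) :
    GrowthTypeAtLeast (fun n => (maxSubmoduleCount ℤ[X] N n : ℝ))
      (fun n => (n : ℝ) ^ (s + r - 1)) := by
  obtain ⟨M, B, hMB⟩ := h.exists_generic
  refine ⟨((B + 1 : ℕ) : ℝ)⁻¹, by positivity, frequently_atTop.2 fun n₀ => ?_⟩
  obtain ⟨p, hp, hpp⟩ := Nat.exists_infinite_primes (M + n₀ + 1)
  have : Fact p.Prime := ⟨hpp⟩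
  obtain ⟨F, i1, i2, i3, α, hα, hcard, hk⟩ := (hMB p (by omega)).2 hs
  have hq : 1 < Nat.card F := Finite.one_lt_card
  refine ⟨Nat.card F, ?_, ?_⟩
  · have h1 : p ^ 1 ≤ p ^ Module.finrank (ZMod p) F :=
      Nat.pow_le_pow_right hpp.pos Module.finrank_pos
    rw [← natCard_eq_pow_finrank p, pow_one] at h1
    omega
  · beta_reduce
    rw [inv_mul_le_iff₀ (by positivity)]
    suffices hnat : Nat.card F ^ (s + r - 1) ≤ (B + 1) * maxSubmoduleCount ℤ[X] N (Nat.card F) by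
      exact_mod_cast hnat
    refine Nat.le_of_mul_le_mul_right ?_ (show 0 < Nat.card F - 1 by omega)
    calc Nat.card F ^ (s + r - 1) * (Nat.card F - 1) ≤ Nat.card F ^ (s + r) - 1 :=
          pow_pred_mul_le_pow_sub_one (by omega) (by omega)
      _ = homCard N α - 1 := by rw [hcard]
      _ ≤ ∑ α ∈ ringGenerators F, (homCard N α - 1) :=
          Finset.single_le_sum (f := fun α => homCard N α - 1) (fun _ _ => Nat.zero_le _) hα
      _ = maxSubmoduleCount ℤ[X] N (Nat.card F) *
          ((Nat.card F - 1) * Module.finrank (ZMod p) F) := (maxSubmoduleCount_mul_eq N p F).symm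
      _ ≤ maxSubmoduleCount ℤ[X] N (Nat.card F) * ((Nat.card F - 1) * (B + 1)) := by
          gcongr; omega
      _ = (B + 1) * maxSubmoduleCount ℤ[X] N (Nat.card F) * (Nat.card F - 1) := by ring

/-- Over the prime field every `α` is a generator, so all `p` points contribute `p ^ r - 1`. -/
theorem HasInvariantFactorForm.growthTypeAtLeast_pow_free {r : ℕ}
    (h : HasInvariantFactorForm N 0 r) (hr : 0 < r) :
    GrowthTypeAtLeast (fun n => (maxSubmoduleCount ℤ[X] N n : ℝ)) (fun n => (n : ℝ) ^ r) := by
  obtain ⟨M, B, hMB⟩ := h.exists_generic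
  refine ⟨1, one_pos, frequently_atTop.2 fun n₀ => ?_⟩
  obtain ⟨p, hp, hpp⟩ := Nat.exists_infinite_primes (M + n₀ + 1)
  have : Fact p.Prime := ⟨hpp⟩
  obtain ⟨-, hcard, -⟩ := (hMB p (by omega)).1 (ZMod p)
  refine ⟨p, by omega, ?_⟩
  have heq := maxSubmoduleCount_mul_eq N p (ZMod p)
  have huniv : ∀ α : ZMod p, α ∈ ringGenerators (ZMod p) := fun α => by
    rw [mem_ringGenerators]
    intro y
    obtain ⟨m, rfl⟩ := ZMod.intCast_surjective y
    exact ⟨m, map_intCast _ m⟩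
  rw [Finset.eq_univ_iff_forall.2 huniv, Finset.sum_congr rfl fun α _ => by rw [hcard α rfl],
    Finset.sum_const, Finset.card_univ, ZMod.card, Nat.card_zmod, Module.finrank_self, mul_one,
    smul_eq_mul] at heq
  beta_reduce
  rw [one_mul]
  suffices hnat : p ^ r ≤ maxSubmoduleCount ℤ[X] N p by exact_mod_cast hnat
  have hp2 := hpp.two_le
  refine Nat.le_of_mul_le_mul_right ?_ (show 0 < p - 1 by omega)
  rw [heq]
  calc p ^ r * (p - 1) = p * (p ^ (r - 1) * (p - 1)) := by
        rw [← mul_assoc, ← pow_succ', Nat.sub_add_cancel (by omega)]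
    _ ≤ p * (p ^ r - 1) := Nat.mul_le_mul_left _ (pow_pred_mul_le_pow_sub_one (by omega) hr)

theorem growthTypeAtLeast_div_log (N : Type u) [AddCommGroup N] [Module ℤ[X] N]
    [Module.Finite ℤ[X] N] (hr : 0 < rankMax N) :
    GrowthTypeAtLeast (fun n => (maxSubmoduleCount ℤ[X] N n : ℝ))
      (fun n => (n : ℝ) ^ rankMax N / Real.log n) := by
  obtain ⟨⟨p, hpp⟩, hpr⟩ := (isGreatest_rankMax N).1
  have : Fact p.Prime := ⟨hpp⟩
  obtain ⟨K, hK⟩ := exists_homCard_eq_pow_rankModP N p hpp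
  have hlogp : 0 < Real.log p := Real.log_pos (by exact_mod_cast hpp.one_lt)
  -- The `2` comes from the proportion of generators, and `log p` from `k = log n / log p`, with `p`
  -- attaining `r_max`.
  refine ⟨Real.log p / 2, by positivity, frequently_atTop.2 fun n₀ => ?_⟩
  obtain ⟨k, hk⟩ : ∃ k, k = K + n₀ + 3 := ⟨_, rfl⟩
  let F := GaloisField p k
  have hfr : Module.finrank (ZMod p) F = k := GaloisField.finrank _ (by omega)
  have hcard : Nat.card F = p ^ k := GaloisField.card _ _ (by omega)
  have heq := maxSubmoduleCount_mul_eq N p F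
  have hgen := natCard_le_two_mul_card_ringGenerators p F (by omega)
  rw [hfr, Finset.sum_congr rfl fun α hα => by rw [hK F (by omega) α hα, hpr],
    Finset.sum_const, smul_eq_mul, hcard] at heq
  rw [hcard] at hgen
  have hq : 1 < p ^ k := Nat.one_lt_pow (by omega) hpp.one_lt
  refine ⟨p ^ k, ?_, ?_⟩
  · have := Nat.lt_pow_self (n := k) hpp.one_lt
    omega
  · have hnat : (p ^ k) ^ rankMax N ≤ 2 * (maxSubmoduleCount ℤ[X] N (p ^ k) * k) := by
      refine Nat.le_of_mul_le_mul_right ?_ (show 0 < p ^ k - 1 by omega)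
      calc (p ^ k) ^ rankMax N * (p ^ k - 1)
          = p ^ k * ((p ^ k) ^ (rankMax N - 1) * (p ^ k - 1)) := by
            rw [← mul_assoc, ← pow_succ', Nat.sub_add_cancel (by omega)]
        _ ≤ (2 * (ringGenerators F).card) * ((p ^ k) ^ rankMax N - 1) :=
            Nat.mul_le_mul hgen (pow_pred_mul_le_pow_sub_one (by omega) hr)
        _ = 2 * (maxSubmoduleCount ℤ[X] N (p ^ k) * ((p ^ k - 1) * k)) := by
            rw [heq, mul_assoc]
        _ = 2 * (maxSubmoduleCount ℤ[X] N (p ^ k) * k) * (p ^ k - 1) := by ring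
    have hreal : ((p ^ k : ℕ) : ℝ) ^ rankMax N ≤
        2 * (maxSubmoduleCount ℤ[X] N (p ^ k) * k : ℝ) := by exact_mod_cast hnat
    have hkpos : (0 : ℝ) < k := by exact_mod_cast (by omega : 0 < k)
    have hlog : Real.log ((p ^ k : ℕ) : ℝ) = k * Real.log p := by
      rw [Nat.cast_pow, Real.log_pow]
    beta_reduce
    rw [hlog, mul_div_assoc', div_le_iff₀ (by positivity)]
    calc Real.log p / 2 * ((p ^ k : ℕ) : ℝ) ^ rankMax N
        ≤ Real.log p / 2 * (2 * (maxSubmoduleCount ℤ[X] N (p ^ k) * k : ℝ)) := by gcongr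
      _ = maxSubmoduleCount ℤ[X] N (p ^ k) * (k * Real.log p) := by ring

end Growth

theorem mainTheorem6 (N : Type*) [AddCommGroup N] [Module ℤ[X] N] [Module.Finite ℤ[X] N]
    [Infinite N] :
    -- the quantities involved are well defined
    (∀ n : ℕ, 0 < n → (maxSubmodules ℤ[X] N n).Finite) ∧
    IsGreatest (Set.range (rankModP N)) (rankMax N) ∧
    (∃ s r : ℕ, HasInvariantFactorForm N s r) ∧
    -- the growth type, with `s = s(0)`, `r = r(0)` and `d = s(0) + r(0)`
    ∀ s r d : ℕ, HasInvariantFactorForm N s r → d = s + r →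
      (rankMax N < d →
        HasGrowthType (fun n => (maxSubmoduleCount ℤ[X] N n : ℝ))
          (fun n => (n : ℝ) ^ (d - 1))) ∧
      (d = rankMax N ∧ rankMax N = r →
        HasGrowthType (fun n => (maxSubmoduleCount ℤ[X] N n : ℝ))
          (fun n => (n : ℝ) ^ d)) ∧
      (¬ rankMax N < d ∧ ¬ (d = rankMax N ∧ rankMax N = r) →
        HasGrowthType (fun n => (maxSubmoduleCount ℤ[X] N n : ℝ))
          (fun n => (n : ℝ) ^ rankMax N / Real.log n)) := by
  refine ⟨finite_maxSubmodules N, isGreatest_rankMax N, exists_hasInvariantFactorForm N, ?_⟩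
  rintro s r d h rfl
  have hr := h.le_rankMax
  -- Here `r ≤ r_max < s + r` gives `s > 0`.
  refine ⟨fun hlt => ⟨h.growthTypeAtMost_pow le_rfl hlt, h.growthTypeAtLeast_pow (by omega)⟩,
    fun ⟨h1, h2⟩ => ?_, fun ⟨h1, h2⟩ => ?_⟩
  · obtain rfl : s = 0 := by omega
    rw [zero_add] at h1 ⊢
    refine ⟨?_, h.growthTypeAtLeast_pow_free (Nat.pos_of_ne_zero ?_)⟩
    · simpa using h.growthTypeAtMost_pow (E := r + 1) (by omega) (by omega)
    · rintro rfl
      refine not_finite_iff_infinite.2 ‹Infinite N› (finite_of_hasInvariantFactorForm_zero N h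
        fun p => ?_)
      have := (isGreatest_rankMax N).2 ⟨p, rfl⟩
      omega
  -- If `r = r_max`, then `d ≤ r_max` would force `s = 0`, which is the second case. So `r < r_max`,
  -- and `r_max > 0`.
  · exact ⟨h.growthTypeAtMost_div_log (by omega) (by omega),
      growthTypeAtLeast_div_log N (by omega)⟩
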